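/- An election has a finite set $C$ of $m\ge 1$ candidates and $n\ge 0$ voters, each of whom has a strict linear order over $C$. Let $N(c,d)$ be the number of voters who prefer $c$ to $d$. The maximin score of a candidate $c$ is $\min_{d\ne c}N(c,d)$, and the maximin winners are the candidates with the highest maximin score (if $m=1$, the only candidate is the winner). An instance $I=(C,V,\Pi,p)$ of maximin-shift-bribery consists of such an election $(C,V)$, a designated candidate $p\in C$, and for each voter $i$ a cost function $\pi^i:\mathbb{Z}_{\ge 0}\to\mathbb{Z}_{\ge 0}$ with $\pi^i(0)=0$, $\pi^i(k)\le\pi^i(k+1)$ for all $k$, and $\pi^i(s)=\pi^i(t-1)$ for all $s\ge t$, where $t$ is the position ($1$ is the top) of $p$ in the vote of $i$. A shift-action is a tuple $\mathbf{t}=(t_1,\dots,t_n)$ of nonnegative integers; it moves $p$ up by $t_i$ positions in the vote of each voter $i$ (to the top if fewer than $t_i$ candidates are above $p$), keeping the order of the other candidates, and its cost is $\Pi(\mathbf{t})=\sum_i\pi^i(t_i)$. It is successful if $p$ is a maximin winner of the resulting election. Let $\mathrm{opt}(I)$ be the minimum cost of a successful shift-action, and let $|I|$ be the representation size of $I$,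 with all costs written in binary. Theorem. There are a deterministic algorithm, a polynomial $q$ and an absolute constant $K$ such that on every instance $I$ of maximin-shift-bribery with $m$ candidates the algorithm halts after at most $q(|I|)$ steps and outputs a successful shift-action $\mathbf{s}$ with $$\Pi(\mathbf{s})\le K\cdot\log m\cdot\mathrm{opt}(I).$$ -/

import Mathlib

/-! ## A random access machine with a step count

Programs of a random access machine over the natural numbers, in structured form. The memory has
finitely many (as many as the program mentions) scalar variables and one-dimensional arrays, all of
whose cells hold natural numbers. The arithmetic operations are addition, truncated subtraction and
halving; there is no multiplication. Every operation, memory access and test costs one unit.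
This is the textbook unit-cost RAM without multiplication, on which polynomial time (measured
against the bit length of the input numbers) coincides with polynomial time on Turing machines. -/

namespace RAM

/-- The memory: scalar variables `var x` and arrays `arr a`, with cells `arr a i`. -/
structure Store where
  var : ℕ → ℕ
  arr : ℕ → ℕ → ℕ

/-- Arithmetic expressions. -/
inductive Expr where
  /-- a constant of the program -/
  | const (c : ℕ)
  /-- the value of a scalar variable -/
  | var (x : ℕ)
  /-- the content of the cell of the array `a` at the address computed by `e` -/
  | get (a : ℕ) (e : Expr)
  | add (e₁ e₂ : Expr)
  /-- truncated subtraction -/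
  | sub (e₁ e₂ : Expr)
  /-- integer division by two -/
  | half (e : Expr)

/-- The value of an expression. -/
def Expr.eval (s : Store) : Expr → ℕ
  | .const c => c
  | .var x => s.var x
  | .get a e => s.arr a (e.eval s)
  | .add e₁ e₂ => e₁.eval s + e₂.eval s
  | .sub e₁ e₂ => e₁.eval s - e₂.eval s
  | .half e => e.eval s / 2

/-- The number of elementary operations that the evaluation of an expression takes. -/
def Expr.cost : Expr → ℕ
  | .const _ => 1
  | .var _ => 1
  | .get _ e => e.cost + 1
  | .add e₁ e₂ => e₁.cost + e₂.cost + 1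
  | .sub e₁ e₂ => e₁.cost + e₂.cost + 1
  | .half e => e.cost + 1

/-- Programs. A test `e` succeeds if its value is not zero. -/
inductive Prog where
  | skip
  /-- `x := e` -/
  | assign (x : ℕ) (e : Expr)
  /-- `a[e₁] := e₂` -/
  | put (a : ℕ) (e₁ e₂ : Expr)
  | seq (P Q : Prog)
  | ite (e : Expr) (P Q : Prog)
  /-- while `e` is not zero, do `P` -/
  | loop (e : Expr) (P : Prog)

/-- `Exec P s k s'`: started in the memory state `s`, the program `P` halts after exactly `k`
elementary steps, in the memory state `s'`. -/
inductive Exec : Prog → Store → ℕ → Store → Prop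
  | skip (s : Store) : Exec .skip s 1 s
  | assign (x : ℕ) (e : Expr) (s : Store) :
      Exec (.assign x e) s (e.cost + 1) ⟨Function.update s.var x (e.eval s), s.arr⟩
  | put (a : ℕ) (e₁ e₂ : Expr) (s : Store) :
      Exec (.put a e₁ e₂) s (e₁.cost + e₂.cost + 1)
        ⟨s.var, Function.update s.arr a (Function.update (s.arr a) (e₁.eval s) (e₂.eval s))⟩
  | seq {P Q : Prog} {s s' s'' : Store} {k l : ℕ} (hP : Exec P s k s') (hQ : Exec Q s' l s'') :
      Exec (.seq P Q) s (k + l) s''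
  | ite_true {e : Expr} {P Q : Prog} {s s' : Store} {k : ℕ} (he : e.eval s ≠ 0)
      (hP : Exec P s k s') : Exec (.ite e P Q) s (e.cost + 1 + k) s'
  | ite_false {e : Expr} {P Q : Prog} {s s' : Store} {k : ℕ} (he : e.eval s = 0)
      (hQ : Exec Q s k s') : Exec (.ite e P Q) s (e.cost + 1 + k) s'
  | loop_false {e : Expr} {P : Prog} {s : Store} (he : e.eval s = 0) :
      Exec (.loop e P) s (e.cost + 1) s
  | loop_true {e : Expr} {P : Prog} {s s' s'' : Store} {k l : ℕ} (he : e.eval s ≠ 0)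
      (hP : Exec P s k s') (hW : Exec (.loop e P) s' l s'') :
      Exec (.loop e P) s (e.cost + 1 + k + l) s''

/-- The machine is deterministic: the running time and the final memory are unique. -/
theorem Exec.deterministic {P : Prog} {s s₁ : Store} {k₁ : ℕ} (h₁ : Exec P s k₁ s₁) :
    ∀ {k₂ : ℕ} {s₂ : Store}, Exec P s k₂ s₂ → k₁ = k₂ ∧ s₁ = s₂ := by
  induction h₁ with
  | skip s => intro k₂ s₂ h; cases h; exact ⟨rfl, rfl⟩
  | assign x e s => intro k₂ s₂ h; cases h; exact ⟨rfl, rfl⟩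
  | put a e₁ e₂ s => intro k₂ s₂ h; cases h; exact ⟨rfl, rfl⟩
  | seq _ _ ihP ihQ =>
    intro k₂ s₂ h
    cases h with
    | seq hP hQ =>
      obtain ⟨rfl, rfl⟩ := ihP hP
      obtain ⟨rfl, rfl⟩ := ihQ hQ
      exact ⟨rfl, rfl⟩
  | ite_true he _ ih =>
    intro k₂ s₂ h
    cases h with
    | ite_true _ hP => obtain ⟨rfl, rfl⟩ := ih hP; exact ⟨rfl, rfl⟩
    | ite_false he' _ => exact absurd he' he
  | ite_false he _ ih =>
    intro k₂ s₂ h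
    cases h with
    | ite_true he' _ => exact absurd he he'
    | ite_false _ hP => obtain ⟨rfl, rfl⟩ := ih hP; exact ⟨rfl, rfl⟩
  | loop_false he =>
    intro k₂ s₂ h
    cases h with
    | loop_false _ => exact ⟨rfl, rfl⟩
    | loop_true he' _ _ => exact absurd he he'
  | loop_true he _ _ ihP ihW =>
    intro k₂ s₂ h
    cases h with
    | loop_false he' => exact absurd he' he
    | loop_true _ hP hW =>
      obtain ⟨rfl, rfl⟩ := ihP hP
      obtain ⟨rfl, rfl⟩ := ihW hW
      exact ⟨rfl, rfl⟩

/-- The initial memory on input `w`: array `0` holds the list `w`; everything else is zero. -/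
def load (w : List ℕ) : Store where
  var _ := 0
  arr a i := if a = 0 then w.getD i 0 else 0

/-- The output is read off array `1` of the final memory. -/
def Store.output (s : Store) (i : ℕ) : ℕ := s.arr 1 i

/-- The bit length of an input: the numbers are written in binary, with one separator each. -/
def bitLength (w : List ℕ) : ℕ := (w.map fun a => Nat.size a + 1).sum

end RAM

/-! ## Elections and the maximin rule -/

/-- An election with candidates `Fin m` and voters `Fin n`. A strict linear order over the
candidates is given by the bijection that maps each candidate to her position (`0` is the top). -/
structure Election (m n : ℕ) where
  pos : Fin n → Equiv.Perm (Fin m)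

namespace Election

variable {m n : ℕ}

/-- `E.N c d` is the number of voters who prefer `c` to `d`. -/
def N (E : Election m n) (c d : Fin m) : ℕ :=
  (Finset.univ.filter fun i : Fin n => E.pos i c < E.pos i d).card

/-- The maximin score of `c`: the minimum of `N c d` over the candidates `d ≠ c`
(by convention `0` if `c` is the only candidate). -/
noncomputable def maximinScore (E : Election m n) (c : Fin m) : ℕ :=
  ⨅ d : {d : Fin m // d ≠ c}, E.N c d

/-- `c` is a maximin winner if no candidate has a higher maximin score. -/
def IsMaximinWinner (E : Election m n) (c : Fin m) : Prop :=
  ∀ d : Fin m, E.maximinScore d ≤ E.maximinScore c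

/-- The position `t` places above `q`, or the top position if there is no such position. -/
def shiftedPos (q : Fin m) (t : ℕ) : Fin m := ⟨q - t, by omega⟩

/-- `E.shift p t` is the election obtained by shifting `p` upwards by `t i` positions in the vote
of each voter `i` (to the top if she has fewer than `t i` candidates above `p`); the candidates
that `p` passes move down by one position. -/
def shift (E : Election m n) (p : Fin m) (t : Fin n → ℕ) : Election m n where
  pos i := (E.pos i).trans (Fin.cycleIcc (shiftedPos (E.pos i p) (t i)) (E.pos i p))

theorem shift_pos_self (E : Election m n) (p : Fin m) (t : Fin n → ℕ) (i : Fin n) :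
    ((E.shift p t).pos i p : ℕ) = E.pos i p - t i := by
  have : NeZero m := ⟨by have := p.isLt; omega⟩
  have h : shiftedPos (E.pos i p) (t i) ≤ E.pos i p := by
    simp only [Fin.le_def, shiftedPos]; omega
  simp only [shift, Equiv.trans_apply]
  rw [Fin.cycleIcc_of_last h]
  rfl

theorem shift_pos_of_ne (E : Election m n) {p c : Fin m} (hc : c ≠ p) (t : Fin n → ℕ)
    (i : Fin n) :
    ((E.shift p t).pos i c : ℕ) =
      if (E.pos i p : ℕ) - t i ≤ E.pos i c ∧ E.pos i c < E.pos i p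
      then (E.pos i c : ℕ) + 1 else E.pos i c := by
  have : NeZero m := ⟨by have := p.isLt; omega⟩
  have hne : E.pos i c ≠ E.pos i p := fun h => hc ((E.pos i).injective h)
  simp only [shift, Equiv.trans_apply]
  split_ifs with h
  · have h1 : shiftedPos (E.pos i p) (t i) ≤ E.pos i c := by
      simp only [Fin.le_def, shiftedPos]; exact h.1
    rw [Fin.cycleIcc_of_ge_of_lt h1 h.2]
    have h2 : (E.pos i c : ℕ) + 1 < m := by
      have := h.2; have := (E.pos i p).isLt; simp only [Fin.lt_def] at *; omega
    exact Fin.val_add_one_of_lt' h2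
  · rcases lt_or_ge (E.pos i c) (E.pos i p) with hl | hl
    · rw [Fin.cycleIcc_of_lt]
      simp only [Fin.lt_def, shiftedPos]
      by_contra h'
      exact h ⟨by omega, hl⟩
    · rw [Fin.cycleIcc_of_gt (lt_of_le_of_ne hl (Ne.symm hne))]

end Election

/-! ## Shift bribery -/

/-- An instance of maximin shift bribery: an election, a designated candidate `p`, and for each
voter `i` a function `cost i`, where `cost i k` is the cost of shifting `p` upwards by `k`
positions in the vote of `i`. -/
structure ShiftBribery where
  /-- the number of candidates -/
  m : ℕ
  /-- the number of voters -/
  n : ℕ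
  election : Election m n
  p : Fin m
  cost : Fin n → ℕ → ℕ
  cost_zero : ∀ i, cost i 0 = 0
  cost_mono : ∀ i k, cost i k ≤ cost i (k + 1)
  /-- shifting `p` beyond the top is the same as shifting `p` to the top -/
  cost_top : ∀ i k, (election.pos i p : ℕ) ≤ k → cost i k = cost i (election.pos i p)

namespace ShiftBribery

/-- The shift-action `t` is successful if it makes `p` a winner. -/
def Successful (I : ShiftBribery) (t : Fin I.n → ℕ) : Prop :=
  (I.election.shift I.p t).IsMaximinWinner I.p

/-- The cost of a shift-action. -/
def totalCost (I : ShiftBribery) (t : Fin I.n → ℕ) : ℕ := ∑ i, I.cost i (t i)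

/-- The minimum cost of a successful shift-action. -/
noncomputable def opt (I : ShiftBribery) : ℕ :=
  sInf {b | ∃ t : Fin I.n → ℕ, I.Successful t ∧ b = I.totalCost t}

/-- Moving `p` to the top of every vote is successful, so that `opt` is an actual minimum. -/
theorem exists_successful (I : ShiftBribery) : ∃ t : Fin I.n → ℕ, I.Successful t := by
  refine ⟨fun i => I.election.pos i I.p, fun d => ?_⟩
  set E := I.election.shift I.p fun i => (I.election.pos i I.p : ℕ) with hE
  rcases eq_or_ne d I.p with rfl | hd
  · exact le_rfl
  have h0 : ∀ i, (E.pos i I.p : ℕ) = 0 := fun i => by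
    rw [hE, Election.shift_pos_self]; omega
  have : Nonempty {c : Fin I.m // c ≠ I.p} := ⟨⟨d, hd⟩⟩
  refine le_ciInf fun c => ?_
  refine (ciInf_le (OrderBot.bddBelow _) ⟨I.p, hd.symm⟩).trans ?_
  refine Finset.card_le_card fun i _ => ?_
  simp only [Finset.mem_filter, Finset.mem_univ, true_and, Fin.lt_def, h0]
  refine Nat.pos_of_ne_zero fun h => c.2 ((E.pos i).injective (Fin.ext ?_))
  rw [h0, h]

/-- The description of an instance as a list of numbers: `m`, `n`, `p`, and then for each voter
her candidates from top to bottom, followed by the costs of shifting `p` by `0, …, m - 1`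
positions. -/
def encode (I : ShiftBribery) : List ℕ :=
  I.m :: I.n :: (I.p : ℕ) ::
    (List.finRange I.n).flatMap fun i =>
      ((List.finRange I.m).map fun j => ((I.election.pos i).symm j : ℕ)) ++
        ((List.finRange I.m).map fun k => I.cost i k)

/-- The representation size of an instance, with all numbers given in binary. -/
def size (I : ShiftBribery) : ℕ := RAM.bitLength I.encode

end ShiftBribery

/-! Guess the score `B ≤ n` of `p` after an optimal shift-action. Shifts of `p` do not affect
comparisons among the other candidates. Hence a rival `c` with `N c d ≤ B` for some `d ≠ p` never
scores more than `B`, and `p` only needs `B` votes against `c`. Every other rival must satisfy `N c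
p ≤ B`, so that `p` needs `max B (n - B)` votes against it. For fixed `B` this is a multicover
problem in which each voter chooses from an increasing chain of sets, the candidates that end up
below `p` (`successful_of_cover`, `exists_cover`).

The covering problem is solved greedily with prices `θ = 0, 1, 3, 7, …`: a change of option is
bought if `m * cost ≤ θ * gain`. Fix any solution `t`. After a pass at price `θ`, a change to an
option of `t` is no longer worth its cost, and at the next price `2 θ + 1` its gain is worth at most
`3 m` times its cost. A fall of a gain from `g` to `g'` is charged to the harmonic difference `H_g -
H_g'`, so that each agent's option in `t` is charged at most `3 H_m` times its cost. This is the
invariant `Charged`; it yields the factor `3 (1 + log m)` in `greedy_cost`. The cheapest result over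
all `B` is within `9 log m` of the optimum.

The number of phases is about the bit length of the total price, hence linear in the input size, and
all other loops have length `n`, `n + 1` or `m`. The program is assembled from closure properties of
the predicates `Calc` (numbers) and `Cmd` (memory transformations), and its meaning is compared with
the abstract algorithm afterwards. -/

/-! ## Expressions and commands computed by programs

Registers `0`–`3` bound the loops and are not written by commands, registers `4`–`7` are the mutable scalars,
and all registers from `8` on hold intermediate results. -/

namespace RAM

/-- The running times are polynomial in this number. -/
def Store.bound (s : Store) : ℕ := s.var 0 + s.var 1 + s.var 2 + s.var 3

/-- The same arrays and the same registers below `d`. -/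
def Agree (d : ℕ) (s s' : Store) : Prop := s.arr = s'.arr ∧ ∀ y < d, s.var y = s'.var y

theorem Agree.refl (d : ℕ) (s : Store) : Agree d s s := ⟨rfl, fun _ _ => rfl⟩

theorem Agree.trans {d : ℕ} {s s' s'' : Store} (h : Agree d s s') (h' : Agree d s' s'') :
    Agree d s s'' :=
  ⟨h.1.trans h'.1, fun y hy => (h.2 y hy).trans (h'.2 y hy)⟩

theorem Agree.mono {d d' : ℕ} {s s' : Store} (h : Agree d' s s') (hd : d ≤ d') : Agree d s s' :=
  ⟨h.1, fun y hy => h.2 y (hy.trans_le hd)⟩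

theorem Agree.bound {d : ℕ} {s s' : Store} (h : Agree d s s') (hd : 8 ≤ d) :
    s.bound = s'.bound := by
  simp only [Store.bound, h.2 0 (by omega), h.2 1 (by omega), h.2 2 (by omega), h.2 3 (by omega)]

theorem Agree.update {d y : ℕ} (hy : d ≤ y) (s : Store) (v : ℕ) :
    Agree d s ⟨Function.update s.var y v, s.arr⟩ :=
  ⟨rfl, fun z hz => by simp [Function.update_of_ne (show z ≠ y by omega)]⟩

theorem Store.var_le_bound (s : Store) {b : ℕ} (hb : b < 4) : s.var b ≤ s.bound := by
  unfold Store.bound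
  interval_cases b <;> omega

/-- `F` is computed in polynomial time by a program that changes only registers from `d₀` on. -/
def Calc (d₀ : ℕ) (F : Store → ℕ) : Prop :=
  8 ≤ d₀ ∧ (∀ s s', Agree d₀ s s' → F s = F s') ∧
    ∀ d ≥ d₀, ∃ (P : Prog) (q : Polynomial ℕ), ∀ s, ∃ k s',
      Exec P s k s' ∧ k ≤ q.eval s.bound ∧ Agree d s s' ∧ s'.var d = F s

/-- The memory transformation `F` is carried out in polynomial time by a program, up to the
registers from `d₀` on. -/
def Cmd (d₀ : ℕ) (F : Store → Store) : Prop :=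
  8 ≤ d₀ ∧ (∀ d ≥ d₀, ∀ s s', Agree d s s' → Agree d (F s) (F s')) ∧
    (∀ s y, y < 4 ∨ 8 ≤ y → (F s).var y = s.var y) ∧
    ∀ d ≥ d₀, ∃ (P : Prog) (q : Polynomial ℕ), ∀ s, ∃ k s',
      Exec P s k s' ∧ k ≤ q.eval s.bound ∧ Agree d (F s) s'

/-- `n` rounds of the indexed transformation `F`. -/
def iter {α : Type*} (n : ℕ) (F : ℕ → α → α) (a : α) : α :=
  Nat.rec a (fun k b => F k b) n

@[simp] theorem iter_zero {α : Type*} (F : ℕ → α → α) (a : α) : iter 0 F a = a := rfl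

@[simp] theorem iter_succ {α : Type*} (n : ℕ) (F : ℕ → α → α) (a : α) :
    iter (n + 1) F a = F n (iter n F a) := rfl

theorem iter_induction {α : Type*} {n : ℕ} {F : ℕ → α → α} {a : α} (Inv : ℕ → α → Prop)
    (h0 : Inv 0 a) (hs : ∀ k < n, ∀ b, Inv k b → Inv (k + 1) (F k b)) : Inv n (iter n F a) := by
  induction n with
  | zero => exact h0
  | succ n ih => exact hs n (by omega) _ (ih fun k hk => hs k (by omega))

/-- The induction runs over the number `j` of rounds that remain, because the counter `k` moves
upwards while the guard has the value `N - k`. -/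
theorem exec_loop {e : Expr} {Body : Prog} {N T : ℕ} (Inv : ℕ → Store → Prop)
    (he : ∀ k s, Inv k s → e.eval s = N - k)
    (hbody : ∀ k < N, ∀ s, Inv k s → ∃ t s', Exec Body s t s' ∧ t ≤ T ∧ Inv (k + 1) s') :
    ∀ (j k : ℕ) (s : Store), k + j = N → Inv k s →
      ∃ t s', Exec (.loop e Body) s t s' ∧ t ≤ j * (e.cost + 1 + T) + (e.cost + 1) ∧ Inv N s' := by
  intro j
  induction j with
  | zero =>
    intro k s hk hs
    obtain rfl : k = N := by omega
    exact ⟨_, s, .loop_false (by rw [he k s hs]; omega), by omega, hs⟩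
  | succ j ih =>
    intro k s hk hs
    obtain ⟨t, s', h1, h2, h3⟩ := hbody k (by omega) s hs
    obtain ⟨t', s'', h4, h5, h6⟩ := ih (k + 1) s' (by omega) h3
    refine ⟨_, s'', .loop_true (by rw [he k s hs]; omega) h1 h4, ?_, h6⟩
    rw [Nat.succ_mul]
    omega

/-! ### Closure properties of computable numerical functions -/

namespace Calc

variable {d : ℕ} {F G H : Store → ℕ}

theorem mono {d' : ℕ} (h : Calc d F) (hd : d ≤ d') : Calc d' F :=
  ⟨h.1.trans hd, fun s s' hs => h.2.1 s s' (hs.mono hd), fun e he => h.2.2 e (hd.trans he)⟩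

theorem congr (h : Calc d F) (hFG : ∀ s, F s = G s) : Calc d G :=
  (funext hFG : F = G) ▸ h

theorem expr (hd : 8 ≤ d) (e : Expr) (he : ∀ s s', Agree d s s' → e.eval s = e.eval s') :
    Calc d fun s => e.eval s := by
  refine ⟨hd, he, fun x hx => ⟨.assign x e, Polynomial.C (e.cost + 1), fun s =>
    ⟨_, _, .assign x e s, by simp, .update le_rfl _ _, by simp⟩⟩⟩

theorem const (hd : 8 ≤ d) (c : ℕ) : Calc d fun _ => c :=
  expr hd (.const c) fun _ _ _ => rfl

theorem var (hd : 8 ≤ d) {y : ℕ} (hy : y < d) : Calc d fun s => s.var y :=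
  expr hd (.var y) fun _ _ h => h.2 y hy

/-- `φ` may read the arrays, so that array access is an instance, but not the registers, some of
which are overwritten while `F` is computed. -/
theorem comp₁ {f' : Expr → Expr} {φ : Store → ℕ → ℕ}
    (hφ : ∀ s s', s.arr = s'.arr → φ s = φ s')
    (hf : ∀ s e, (f' e).eval s = φ s (e.eval s)) (hF : Calc d F) :
    Calc d fun s => φ s (F s) := by
  refine ⟨hF.1, fun s s' h => by simp only [hF.2.1 s s' h, hφ s s' h.1], fun x hx => ?_⟩
  obtain ⟨P, q, hP⟩ := hF.2.2 x hx
  refine ⟨.seq P (.assign x (f' (.var x))), q + Polynomial.C ((f' (.var x)).cost + 1),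
    fun s => ?_⟩
  obtain ⟨k, s₁, h1, h2, h3, h4⟩ := hP s
  refine ⟨_, _, .seq h1 (.assign _ _ _), by simpa using h2, h3.trans (.update le_rfl _ _), ?_⟩
  simp only [Function.update_self, hf, Expr.eval, h4, hφ s s₁ h3.1]

theorem get (a : ℕ) (hF : Calc d F) : Calc d fun s => s.arr a (F s) :=
  comp₁ (f' := .get a) (φ := fun s => s.arr a) (fun s s' h => by simp only [h])
    (fun _ _ => rfl) hF

/-- The registers act as a stack: the first value waits in `x` while the second one is computed from
`x + 1` on. -/
theorem comp₂ {f : ℕ → ℕ → ℕ} {f' : Expr → Expr → Expr}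
    (hf : ∀ s e₁ e₂, (f' e₁ e₂).eval s = f (e₁.eval s) (e₂.eval s))
    (hF : Calc d F) (hG : Calc d G) : Calc d fun s => f (F s) (G s) := by
  refine ⟨hF.1, fun s s' h => by simp only [hF.2.1 s s' h, hG.2.1 s s' h], fun x hx => ?_⟩
  obtain ⟨P, q, hP⟩ := hF.2.2 x hx
  obtain ⟨Q, r, hQ⟩ := hG.2.2 (x + 1) (by omega)
  refine ⟨.seq P (.seq Q (.assign x (f' (.var x) (.var (x + 1))))),
    q + r + Polynomial.C ((f' (.var x) (.var (x + 1))).cost + 1), fun s => ?_⟩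
  obtain ⟨k, s₁, h1, h2, h3, h4⟩ := hP s
  obtain ⟨l, s₂, h5, h6, h7, h8⟩ := hQ s₁
  have := hF.1
  refine ⟨_, _, .seq h1 (.seq h5 (.assign _ _ _)), ?_,
    (h3.trans (h7.mono (by omega))).trans (.update le_rfl _ _), ?_⟩
  · rw [← h3.bound (by omega)] at h6
    simp only [Polynomial.eval_add, Polynomial.eval_C]
    omega
  · simp only [Function.update_self, hf, Expr.eval, h8, ← h7.2 x (by omega), h4,
      hG.2.1 s s₁ (h3.mono hx)]

theorem add (hF : Calc d F) (hG : Calc d G) : Calc d fun s => F s + G s :=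
  comp₂ (f' := .add) (fun _ _ _ => rfl) hF hG

theorem sub (hF : Calc d F) (hG : Calc d G) : Calc d fun s => F s - G s :=
  comp₂ (f' := .sub) (fun _ _ _ => rfl) hF hG

/-- `p` is decided in polynomial time. -/
def _root_.RAM.Dec (d : ℕ) (p : Store → Prop) [DecidablePred p] : Prop :=
  Calc d fun s => if p s then 1 else 0

theorem ite {p : Store → Prop} [DecidablePred p] (hp : Dec d p) (hF : Calc d F)
    (hG : Calc d G) : Calc d fun s => if p s then F s else G s := by
  have hloc : ∀ s s', Agree d s s' → (p s ↔ p s') := fun s s' h => by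
    have := hp.2.1 s s' h
    by_cases h1 : p s <;> by_cases h2 : p s' <;> simp_all
  refine ⟨hF.1, fun s s' h => by simp only [hF.2.1 s s' h, hG.2.1 s s' h, hloc s s' h],
    fun x hx => ?_⟩
  obtain ⟨R, u, hR⟩ := hp.2.2 x hx
  obtain ⟨P, q, hP⟩ := hF.2.2 x hx
  obtain ⟨Q, r, hQ⟩ := hG.2.2 x hx
  refine ⟨.seq R (.ite (.var x) P Q), u + q + r + Polynomial.C 2, fun s => ?_⟩
  obtain ⟨k, s₁, h1, h2, h3, h4⟩ := hR s
  have hb := h3.bound (hF.1.trans hx)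
  simp only [Polynomial.eval_add, Polynomial.eval_C]
  by_cases h : p s
  · obtain ⟨l, s₂, h5, h6, h7, h8⟩ := hP s₁
    refine ⟨_, s₂, .seq h1 (.ite_true (by simp [Expr.eval, h4, h]) h5), ?_, h3.trans h7, ?_⟩
    · rw [← hb] at h6
      simp only [Expr.cost]
      omega
    · rw [h8, if_pos h, hF.2.1 s s₁ (h3.mono hx)]
  · obtain ⟨l, s₂, h5, h6, h7, h8⟩ := hQ s₁
    refine ⟨_, s₂, .seq h1 (.ite_false (by simp [Expr.eval, h4, h]) h5), ?_, h3.trans h7, ?_⟩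
    · rw [← hb] at h6
      simp only [Expr.cost]
      omega
    · rw [h8, if_neg h, hG.2.1 s s₁ (h3.mono hx)]

/-- The summand is required at every computable index: the counter register as index gives one
program for all rounds, and constant indices show that each term ignores the registers from `d` on.
-/
theorem sum {b : ℕ} (hb : b < 4) (hd : 8 ≤ d) {F : ℕ → Store → ℕ}
    (h : ∀ x ≥ d, ∀ G : Store → ℕ, Calc x G → Calc x fun s => F (G s) s) :
    Calc d fun s => ∑ k ∈ Finset.range (s.var b), F k s := by
  have hloc : ∀ k s s', Agree d s s' → F k s = F k s' := fun k =>
    (h d le_rfl _ (const hd k)).2.1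
  refine ⟨hd, fun s s' hs => ?_, fun x hx => ?_⟩
  · simp only [hs.2 b (by omega)]
    exact Finset.sum_congr rfl fun k _ => hloc k s s' hs
  -- Register `x` holds the partial sum, `x + 1` the counter and `x + 2` the current term.
  obtain ⟨P, q, hP⟩ := (h (x + 2) (by omega) _ (var (y := x + 1) (by omega) (by omega))).2.2
    (x + 2) le_rfl
  refine ⟨.seq (.assign x (.const 0)) (.seq (.assign (x + 1) (.const 0))
    (.loop (.sub (.var b) (.var (x + 1))) (.seq P (.seq
      (.assign x (.add (.var x) (.var (x + 2))))
      (.assign (x + 1) (.add (.var (x + 1)) (.const 1))))))),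
    Polynomial.X * (Polynomial.C 12 + q) + Polynomial.C 8, fun s => ?_⟩
  set s₀ : Store := ⟨Function.update (Function.update s.var x 0) (x + 1) 0, s.arr⟩ with hs₀
  obtain ⟨t, s', h1, h2, h3, h4, h5⟩ := exec_loop (N := s.var b) (T := q.eval s.bound + 8)
    (e := .sub (.var b) (.var (x + 1)))
    (Body := .seq P (.seq (.assign x (.add (.var x) (.var (x + 2))))
      (.assign (x + 1) (.add (.var (x + 1)) (.const 1)))))
    (fun k s' => Agree x s s' ∧ s'.var (x + 1) = k ∧
      s'.var x = ∑ j ∈ Finset.range k, F j s)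
    (fun k s' hk => by simp only [Expr.eval, hk.2.1, ← hk.1.2 b (by omega)])
    (fun k _ s' ⟨hk, hk1, hk2⟩ => by
      obtain ⟨t, s₁, h1, h2, h3, h4⟩ := hP s'
      refine ⟨_, _, .seq h1 (.seq (.assign _ _ _) (.assign _ _ _)), ?_, ?_, ?_, ?_⟩
      · rw [← hk.bound (by omega)] at h2
        simp only [Expr.cost]
        omega
      · exact (hk.trans (h3.mono (by omega))).trans
          ((Agree.update le_rfl _ _).trans (.update (by omega) _ _))
      · simp [Expr.eval, ← h3.2 (x + 1) (by omega), hk1]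
      · simp only [Expr.eval, ne_eq, left_eq_add, one_ne_zero, not_false_eq_true,
          Function.update_of_ne, Function.update_self, h4, ← h3.2 x (by omega), hk1, hk2,
          Finset.sum_range_succ, hloc k s s' (hk.mono hx)])
    (s.var b) 0 s₀ (by omega)
    ⟨(Agree.update le_rfl _ _).trans (.update (y := x + 1) (by omega)
      ⟨Function.update s.var x 0, s.arr⟩ _), by simp [hs₀], by simp [hs₀]⟩
  refine ⟨_, s', .seq (.assign _ _ _) (.seq (.assign _ _ _) h1), ?_, h3, h5⟩
  have := Nat.mul_le_mul_right (12 + q.eval s.bound) (s.var_le_bound hb)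
  simp only [Expr.cost, Polynomial.eval_add, Polynomial.eval_mul, Polynomial.eval_X,
    Polynomial.eval_C] at h2 ⊢
  rw [show 1 + 1 + 1 + 1 + (Polynomial.eval s.bound q + 8) = 12 + q.eval s.bound by ring] at h2
  omega

/-- With truncated subtraction, `1 - (1 - x)` is the indicator of `0 < x`, so comparisons need no
branching. -/
theorem lt (hF : Calc d F) (hG : Calc d G) : Dec d fun s => F s < G s := by
  have := (const hF.1 1).sub ((const hF.1 1).sub (hG.sub hF))
  refine this.congr fun s => ?_
  split_ifs <;> omega

theorem le (hF : Calc d F) (hG : Calc d G) : Dec d fun s => F s ≤ G s := by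
  have := (const hF.1 1).sub (hF.sub hG)
  refine this.congr fun s => ?_
  split_ifs <;> omega

theorem eq (hF : Calc d F) (hG : Calc d G) : Dec d fun s => F s = G s := by
  have := (const hF.1 1).sub ((hF.sub hG).add (hG.sub hF))
  refine this.congr fun s => ?_
  split_ifs <;> omega

end Calc

namespace Dec

variable {d : ℕ} {p r : Store → Prop} [DecidablePred p] [DecidablePred r]

theorem and (hp : Dec d p) (hr : Dec d r) : Dec d fun s => p s ∧ r s := by
  have := Calc.ite hp hr (Calc.const hp.1 0)
  refine this.congr fun s => ?_
  by_cases h : p s <;> simp [h]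

theorem or (hp : Dec d p) (hr : Dec d r) : Dec d fun s => p s ∨ r s := by
  have := Calc.ite hp (Calc.const hp.1 1) hr
  refine this.congr fun s => ?_
  by_cases h : p s <;> simp [h]

theorem not (hp : Dec d p) : Dec d fun s => ¬ p s := by
  have := Calc.ite hp (Calc.const hp.1 0) (Calc.const hp.1 1)
  refine this.congr fun s => ?_
  by_cases h : p s <;> simp [h]

end Dec

/-- `x := v` -/
def Store.setVar (s : Store) (x v : ℕ) : Store := ⟨Function.update s.var x v, s.arr⟩

/-- `a[i] := v` -/
def Store.setArr (s : Store) (a i v : ℕ) : Store :=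
  ⟨s.var, Function.update s.arr a (Function.update (s.arr a) i v)⟩

/-! ### Closure properties of memory transformations -/

namespace Cmd

variable {d : ℕ} {F G : Store → Store} {E V : Store → ℕ}

theorem skip (hd : 8 ≤ d) : Cmd d fun s => s :=
  ⟨hd, fun _ _ _ _ h => h, fun _ _ _ => rfl, fun _ _ =>
    ⟨.skip, Polynomial.C 1, fun s => ⟨1, s, .skip s, by simp, .refl _ _⟩⟩⟩

theorem assign {x : ℕ} (hx : 4 ≤ x ∧ x < 8) (hV : Calc d V) : Cmd d fun s => s.setVar x (V s) := by
  have hd := hV.1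
  refine ⟨hd, fun e he s s' h => ⟨h.1, fun y hy => ?_⟩, fun s y hy => ?_, fun e he => ?_⟩
  · simp only [Store.setVar, hV.2.1 s s' (h.mono he), Function.update_apply, h.2 y hy]
  · simp [Store.setVar, Function.update_of_ne (show y ≠ x by omega)]
  · obtain ⟨P, q, hP⟩ := hV.2.2 e he
    refine ⟨.seq P (.assign x (.var e)), q + Polynomial.C 2, fun s => ?_⟩
    obtain ⟨k, s₁, h1, h2, h3, h4⟩ := hP s
    refine ⟨_, _, .seq h1 (.assign _ _ _), by simpa [Expr.cost] using h2, h3.1, fun y hy => ?_⟩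
    simp only [Store.setVar, Expr.eval, h4, Function.update_apply, h3.2 y hy]

theorem put (a : ℕ) (hE : Calc d E) (hV : Calc d V) : Cmd d fun s => s.setArr a (E s) (V s) := by
  have hd := hV.1
  refine ⟨hd, fun e he s s' h => ⟨?_, h.2⟩, fun s y hy => rfl, fun e he => ?_⟩
  · simp only [Store.setArr, hV.2.1 s s' (h.mono he), hE.2.1 s s' (h.mono he), h.1]
  · obtain ⟨P, q, hP⟩ := hE.2.2 e he
    obtain ⟨Q, r, hQ⟩ := hV.2.2 (e + 1) (by omega)
    refine ⟨.seq P (.seq Q (.put a (.var e) (.var (e + 1)))), q + r + Polynomial.C 3,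
      fun s => ?_⟩
    obtain ⟨k, s₁, h1, h2, h3, h4⟩ := hP s
    obtain ⟨l, s₂, h5, h6, h7, h8⟩ := hQ s₁
    rw [← h3.bound (by omega)] at h6
    refine ⟨_, _, .seq h1 (.seq h5 (.put _ _ _ _)), ?_, ?_, fun y hy => ?_⟩
    · simp only [Expr.cost, Polynomial.eval_add, Polynomial.eval_C]
      omega
    · simp only [Store.setArr, Expr.eval, h8, ← h7.2 e (by omega), h4, ← h7.1, ← h3.1,
        hV.2.1 s s₁ (h3.mono he)]
    · simp only [Store.setArr, h3.2 y hy, h7.2 y (by omega)]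

theorem bound (h : Cmd d F) (s : Store) : (F s).bound = s.bound := by
  simp only [Store.bound, h.2.2.1 s 0 (by omega), h.2.2.1 s 1 (by omega),
    h.2.2.1 s 2 (by omega), h.2.2.1 s 3 (by omega)]

theorem seq (hF : Cmd d F) (hG : Cmd d G) : Cmd d fun s => G (F s) := by
  have hd := hF.1
  refine ⟨hd, fun e he s s' h => hG.2.1 e he _ _ (hF.2.1 e he _ _ h),
    fun s y hy => by rw [hG.2.2.1 _ y hy, hF.2.2.1 _ y hy], fun e he => ?_⟩
  obtain ⟨P, q, hP⟩ := hF.2.2.2 e he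
  obtain ⟨Q, r, hQ⟩ := hG.2.2.2 e he
  refine ⟨.seq P Q, q + r, fun s => ?_⟩
  obtain ⟨k, s₁, h1, h2, h3⟩ := hP s
  obtain ⟨l, s₂, h5, h6, h7⟩ := hQ s₁
  rw [← h3.bound (by omega), hF.bound] at h6
  exact ⟨_, _, .seq h1 h5, by rw [Polynomial.eval_add]; omega,
    (hG.2.1 e he _ _ h3).trans h7⟩

theorem ite {p : Store → Prop} [DecidablePred p] (hp : Dec d p) (hF : Cmd d F) :
    Cmd d fun s => if p s then F s else s := by
  have hd := hF.1
  have hloc : ∀ s s', Agree d s s' → (p s ↔ p s') := fun s s' h => by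
    have := hp.2.1 s s' h
    by_cases h1 : p s <;> by_cases h2 : p s' <;> simp_all
  refine ⟨hd, fun e he s s' h => ?_, fun s y hy => ?_, fun e he => ?_⟩
  · simp only [hloc s s' (h.mono he)]
    split_ifs
    exacts [hF.2.1 e he _ _ h, h]
  · beta_reduce
    split_ifs
    exacts [hF.2.2.1 s y hy, rfl]
  obtain ⟨R, u, hR⟩ := hp.2.2 e he
  obtain ⟨P, q, hP⟩ := hF.2.2.2 e he
  refine ⟨.seq R (.ite (.var e) P .skip), u + q + Polynomial.C 3, fun s => ?_⟩
  obtain ⟨k, s₁, h1, h2, h3, h4⟩ := hR s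
  have hb := h3.bound (hd.trans he)
  simp only [Polynomial.eval_add, Polynomial.eval_C]
  by_cases h : p s
  · obtain ⟨l, s₂, h5, h6, h7⟩ := hP s₁
    refine ⟨_, s₂, .seq h1 (.ite_true (by simp [Expr.eval, h4, h]) h5), ?_, ?_⟩
    · rw [← hb] at h6
      simp only [Expr.cost]
      omega
    · rw [if_pos h]
      exact (hF.2.1 e he _ _ h3).trans h7
  · refine ⟨_, s₁, .seq h1 (.ite_false (by simp [Expr.eval, h4, h]) (.skip _)), ?_, ?_⟩
    · simp only [Expr.cost]
      omega
    · rwa [if_neg h]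

/-- `A` does not depend on anything that commands change. -/
def _root_.RAM.Stable {α : Type*} (A : Store → α) : Prop :=
  ∀ s s' : Store, (∀ y, y < 4 ∨ 8 ≤ y → s.var y = s'.var y) → A s = A s'

theorem stable_eq {α : Type*} {A : Store → α} (hA : Stable A) (hF : Cmd d F) (s : Store) :
    A (F s) = A s :=
  hA _ _ fun y hy => hF.2.2.1 s y hy

theorem congr (h : Cmd d F) (hFG : ∀ s, F s = G s) : Cmd d G :=
  (funext hFG : F = G) ▸ h

theorem seq_of_stable {α : Type*} {A : Store → α} {G : α → Store → Store} (hA : Stable A)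
    (hF : Cmd d F) (hG : Cmd d fun s => G (A s) s) : Cmd d fun s => G (A s) (F s) :=
  (hF.seq hG).congr fun s => by rw [hF.stable_eq hA]

/-- As for sums, the body is required at every computable index. The index is moreover stable, so
that inner loops can take it as a parameter: the counter sits above the registers that commands
modify. -/
theorem loop {b : ℕ} (hb : b < 4) (hd : 8 ≤ d) {F : ℕ → Store → Store}
    (h : ∀ x ≥ d, ∀ G : Store → ℕ, Calc x G → Stable G → Cmd x fun s => F (G s) s) :
    Cmd d fun s => iter (s.var b) F s := by
  have hloc : ∀ k, ∀ e ≥ d, ∀ s s', Agree e s s' → Agree e (F k s) (F k s') := fun k =>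
    (h d le_rfl _ (.const hd k) fun _ _ _ => rfl).2.1
  have hvar : ∀ k s y, y < 4 ∨ 8 ≤ y → (F k s).var y = s.var y := fun k =>
    (h d le_rfl _ (.const hd k) fun _ _ _ => rfl).2.2.1
  refine ⟨hd, fun e he s s' hs => ?_, fun s y hy => ?_, fun x hx => ?_⟩
  · simp only [hs.2 b (by omega)]
    induction s'.var b with
    | zero => exact hs
    | succ k ih => exact hloc k e he _ _ ih
  · exact iter_induction (fun _ s' => s'.var y = s.var y) rfl
      fun k _ s' h' => (hvar k s' y hy).trans h'
  obtain ⟨P, q, hP⟩ := (h (x + 1) (by omega) _ (.var (y := x) (by omega) (by omega))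
    fun _ _ h => h x (by omega)).2.2.2
    (x + 1) le_rfl
  refine ⟨.seq (.assign x (.const 0))
    (.loop (.sub (.var b) (.var x)) (.seq P (.assign x (.add (.var x) (.const 1))))),
    Polynomial.X * (Polynomial.C 8 + q) + Polynomial.C 6, fun s => ?_⟩
  set s₀ : Store := ⟨Function.update s.var x 0, s.arr⟩ with hs₀
  obtain ⟨t, s', h1, h2, h3, h4⟩ := exec_loop (N := s.var b) (T := q.eval s.bound + 4)
    (e := .sub (.var b) (.var x))
    (Body := .seq P (.assign x (.add (.var x) (.const 1))))
    (fun k s' => Agree x (iter k F s) s' ∧ s'.var x = k)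
    (fun k s' ⟨hk, hk1⟩ => by
      have : (iter k F s).var b = s.var b :=
        iter_induction (fun _ s' => s'.var b = s.var b) rfl
          fun k _ s' h' => (hvar k s' b (.inl hb)).trans h'
      simp only [Expr.eval, hk1, ← hk.2 b (by omega), this])
    (fun k _ s' ⟨hk, hk1⟩ => by
      obtain ⟨t, s₁, h1, h2, h3⟩ := hP s'
      have hbd : (iter k F s).bound = s.bound := by
        refine iter_induction (fun _ (s' : Store) => s'.bound = s.bound) rfl fun k _ s' h' => ?_
        rw [← h', (h d le_rfl _ (.const hd k) fun _ _ _ => rfl).bound]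
      refine ⟨_, _, .seq h1 (.assign _ _ _), ?_, ?_, ?_⟩
      · rw [← hk.bound (by omega), hbd] at h2
        simp only [Expr.cost]
        omega
      · simp only [hk1] at h3
        exact ((hloc k x hx _ _ hk).trans (h3.mono (by omega))).trans (.update le_rfl _ _)
      · simp [Expr.eval, ← h3.2 x (by omega), hvar _ _ x (by omega), hk1])
    (s.var b) 0 s₀ (by omega) ⟨.update le_rfl _ _, by simp [hs₀]⟩
  refine ⟨_, s', .seq (.assign _ _ _) h1, ?_, h3⟩
  have := Nat.mul_le_mul_right (8 + q.eval s.bound) (s.var_le_bound hb)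
  simp only [Expr.cost, Polynomial.eval_add, Polynomial.eval_mul, Polynomial.eval_X,
    Polynomial.eval_C] at h2 ⊢
  rw [show 1 + 1 + 1 + 1 + (Polynomial.eval s.bound q + 4) = 8 + q.eval s.bound by ring] at h2
  omega

/-- Each round reads `A` off the current memory; no round changes what `A` depends on, so the value
from the start persists. -/
theorem loop_of_stable {α : Type*} {A : Store → α} {b : ℕ} (hA : Stable A) (hb : b < 4)
    (hd : 8 ≤ d) {F : α → ℕ → Store → Store}
    (h : ∀ x ≥ d, ∀ G : Store → ℕ, Calc x G → Stable G → Cmd x fun s => F (A s) (G s) s) :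
    Cmd d fun s => iter (s.var b) (F (A s)) s := by
  refine (loop hb hd (F := fun k s => F (A s) k s) h).congr fun s => ?_
  induction s.var b with
  | zero => rfl
  | succ k ih =>
    have hst : A (iter k (F (A s)) s) = A s := by
      rw [← ih]
      exact iter_induction (fun _ s' => A s' = A s) rfl fun k _ s' h' =>
        ((h d le_rfl _ (.const hd k) fun _ _ _ => rfl).stable_eq hA s').trans h'
    simp only [iter_succ, ih, hst]

end Cmd

end RAM

/-! ## A greedy algorithm for covering by chains of sets -/

/-- A covering problem: the `t`-th option of the agent `i < n` covers the elements `c < m` with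
`cov i t c`, at the cost `cst i t`, and every element `c` has to be covered by at least `dem c`
agents. Higher options cover more. -/
structure ChainCover where
  n : ℕ
  m : ℕ
  cov : ℕ → ℕ → ℕ → Prop
  cst : ℕ → ℕ → ℕ
  dem : ℕ → ℕ
  cov_mono : ∀ i c t t', t ≤ t' → cov i t c → cov i t' c
  cov_last : ∀ i < n, ∀ c < m, cov i (m - 1) c
  cst_zero : ∀ i, cst i 0 = 0
  dem_le : ∀ c, dem c ≤ n

namespace ChainCover

open Classical RAM

variable (C : ChainCover)

/-- The number of agents that cover `c`, if each agent `i` takes the option `v i`. -/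
noncomputable def cnt (v : ℕ → ℕ) (c : ℕ) : ℕ :=
  ∑ i ∈ Finset.range C.n, if C.cov i (v i) c then 1 else 0

/-- The number of elements of unmet demand that `i` covers in addition by changing to `t`. -/
noncomputable def gain (v : ℕ → ℕ) (i t : ℕ) : ℕ :=
  ∑ c ∈ Finset.range C.m,
    if C.cnt v c < C.dem c ∧ C.cov i t c ∧ ¬ C.cov i (v i) c then 1 else 0

/-- The unmet demand. -/
noncomputable def deficit (v : ℕ → ℕ) : ℕ := ∑ c ∈ Finset.range C.m, (C.dem c - C.cnt v c)

/-- The agent `i` changes to `t` if each unit of gain costs at most `θ / m`. -/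
noncomputable def step (θ i t : ℕ) (v : ℕ → ℕ) : ℕ → ℕ :=
  if v i < t ∧ C.m * C.cst i t ≤ θ * C.gain v i t then Function.update v i t else v

noncomputable def row (θ i : ℕ) (v : ℕ → ℕ) : ℕ → ℕ := iter C.m (C.step θ i) v

noncomputable def pass (θ : ℕ) (v : ℕ → ℕ) : ℕ → ℕ := iter C.n (C.row θ) v

/-- The prices are `0, 1, 3, 7, …`. -/
noncomputable def phase (x : ℕ × (ℕ → ℕ)) : ℕ × (ℕ → ℕ) := (x.1 + x.1 + 1, C.pass x.1 x.2)

/-- The start `v` is a parameter because the machine clears only the first `n` cells of its array;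
the other entries are arbitrary. -/
noncomputable def greedy (v : ℕ → ℕ) (L : ℕ) : ℕ × (ℕ → ℕ) := iter L (fun _ => C.phase) (0, v)

variable {C} {v v' t : ℕ → ℕ} {θ i j k : ℕ}

theorem cnt_mono (h : v ≤ v') (c : ℕ) : C.cnt v c ≤ C.cnt v' c := by
  refine Finset.sum_le_sum fun i _ => ?_
  have := C.cov_mono i c _ _ (h i)
  split_ifs <;> simp_all

/-- Submodularity: the more is covered, the fewer elements have unmet demand, and the fewer are new
to `i`. -/
theorem gain_anti (h : v ≤ v') (i k : ℕ) : C.gain v' i k ≤ C.gain v i k := by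
  refine Finset.sum_le_sum fun c _ => ?_
  have h1 := C.cov_mono i c _ _ (h i)
  have h2 := C.cnt_mono h c
  by_cases hc : C.cnt v' c < C.dem c ∧ C.cov i k c ∧ ¬ C.cov i (v' i) c
  · rw [if_pos hc, if_pos ⟨by omega, hc.2.1, fun h => hc.2.2 (h1 h)⟩]
  · rw [if_neg hc]
    exact Nat.zero_le _

theorem gain_le (v : ℕ → ℕ) (i k : ℕ) : C.gain v i k ≤ C.m := by
  refine (Finset.sum_le_card_nsmul _ _ 1 fun c _ => ?_).trans (by simp)
  split_ifs <;> simp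

theorem gain_eq_zero (h : k ≤ v i) : C.gain v i k = 0 := by
  refine Finset.sum_eq_zero fun c _ => if_neg fun hc => hc.2.2 (C.cov_mono i c _ _ h hc.2.1)

theorem cnt_update (hi : i < C.n) (h : v i < k) (c : ℕ) :
    C.cnt (Function.update v i k) c =
      C.cnt v c + if C.cov i k c ∧ ¬ C.cov i (v i) c then 1 else 0 := by
  have hi' : i ∈ Finset.range C.n := Finset.mem_range.2 hi
  unfold cnt
  rw [← Finset.add_sum_erase _ _ hi', ← Finset.add_sum_erase _ _ hi', Function.update_self]
  rw [Finset.sum_congr (g := fun j => if C.cov j (v j) c then 1 else 0) rfl fun j hj => by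
    rw [Function.update_of_ne (Finset.ne_of_mem_erase hj)]]
  have := C.cov_mono i c _ _ h.le
  by_cases h1 : C.cov i k c <;> by_cases h2 : C.cov i (v i) c <;> simp_all
  omega

/-- `gain` counts only elements of unmet demand, and each of them receives exactly one more unit. -/
theorem deficit_update (hi : i < C.n) (h : v i < k) :
    C.deficit (Function.update v i k) + C.gain v i k ≤ C.deficit v := by
  unfold deficit gain
  rw [← Finset.sum_add_distrib]
  refine Finset.sum_le_sum fun c _ => ?_
  rw [cnt_update hi h]
  by_cases h1 : C.cov i k c ∧ ¬ C.cov i (v i) c <;> by_cases h2 : C.cnt v c < C.dem c <;>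
    simp [h1, h2] <;> omega

/-- An element that lacks `r` units is covered under `t` by at least `r` agents that do not cover it
under `v`; then count pairs. -/
theorem deficit_le (ht : ∀ c < C.m, C.dem c ≤ C.cnt t c) (v : ℕ → ℕ) :
    C.deficit v ≤ ∑ i ∈ Finset.range C.n, C.gain v i (t i) := by
  unfold deficit gain
  rw [Finset.sum_comm]
  refine Finset.sum_le_sum fun c hc => ?_
  by_cases h : C.cnt v c < C.dem c
  · simp only [h, true_and]
    have h1 := ht c (Finset.mem_range.1 hc)
    suffices C.cnt t c ≤ C.cnt v c +
        ∑ i ∈ Finset.range C.n, if C.cov i (t i) c ∧ ¬ C.cov i (v i) c then 1 else 0 by omega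
    unfold cnt
    rw [← Finset.sum_add_distrib]
    refine Finset.sum_le_sum fun i _ => ?_
    by_cases h2 : C.cov i (t i) c <;> by_cases h3 : C.cov i (v i) c <;> simp [h2, h3]
  · rw [Nat.sub_eq_zero_of_le (by omega)]
    exact Nat.zero_le _

/-- `a (H_a - H_b)` is a sum of `a - b` terms `a / j` with `j ≤ a`, each at least `1`. -/
theorem sub_le_mul_harmonic_sub {a b : ℕ} (h : b ≤ a) :
    (a : ℝ) - b ≤ a * ((harmonic a : ℝ) - harmonic b) ∧
      (harmonic b : ℝ) ≤ harmonic a := by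
  induction a, h using Nat.le_induction with
  | base => simp
  | succ a _ ih =>
    have ha : (0 : ℝ) < a + 1 := by positivity
    rw [harmonic_succ]
    push_cast
    have : ((a : ℝ) + 1)⁻¹ * (a + 1) = 1 := inv_mul_cancel₀ ha.ne'
    have := inv_pos.2 ha
    constructor <;> nlinarith

/-- The bound on the cost during the algorithm, in comparison with a solution `t`. -/
def Charged (C : ChainCover) (t : ℕ → ℕ) (θ : ℕ) (v : ℕ → ℕ) : Prop :=
  (∀ i < C.n, θ * C.gain v i (t i) ≤ 3 * (C.m * C.cst i (t i))) ∧
  (C.m * ∑ i ∈ Finset.range C.n, (C.cst i (v i) : ℝ)) ≤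
    ∑ i ∈ Finset.range C.n, 3 * (C.m * (C.cst i (t i) : ℝ)) *
      ((harmonic C.m : ℝ) - harmonic (C.gain v i (t i))) +
    θ * ((∑ i ∈ Finset.range C.n, (C.gain v i (t i) : ℝ)) - C.deficit v)

theorem le_update (h : v i < k) : v ≤ Function.update v i k := by
  intro j
  by_cases hj : j = i
  · subst hj
    simpa using h.le
  · simp [hj]

theorem le_step (θ i k : ℕ) (v : ℕ → ℕ) : v ≤ C.step θ i k v := by
  unfold step
  split_ifs with h
  · exact le_update h.1
  · exact le_rfl

/-- The new expense is at most `θ` times the gain, and the deficit falls by at least this gain,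
which pays for it. The losses in the gains towards `t` are made up by the harmonic terms. -/
theorem Charged.step (h : C.Charged t θ v) (hi : i < C.n) (k : ℕ) :
    C.Charged t θ (C.step θ i k v) := by
  unfold ChainCover.step
  split_ifs with hk
  swap
  · exact h
  set v' := Function.update v i k with hv'
  have hle : v ≤ v' := le_update hk.1
  refine ⟨fun j hj => (Nat.mul_le_mul_left θ (gain_anti hle j _)).trans (h.1 j hj), ?_⟩
  -- The cost of the option that `i` gives up is dropped; only its nonnegativity is used.
  have hpaid : (∑ j ∈ Finset.range C.n, (C.cst j (v' j) : ℝ)) ≤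
      ∑ j ∈ Finset.range C.n, (C.cst j (v j) : ℝ) + C.cst i k := by
    have hi' : i ∈ Finset.range C.n := Finset.mem_range.2 hi
    rw [← Finset.add_sum_erase _ _ hi', ← Finset.add_sum_erase _ _ hi', hv',
      Function.update_self]
    rw [Finset.sum_congr (g := fun j => (C.cst j (v j) : ℝ)) rfl fun j hj => by
      rw [Function.update_of_ne (Finset.ne_of_mem_erase hj)]]
    have : (0 : ℝ) ≤ C.cst i (v i) := by positivity
    linarith
  have hcost : (C.m : ℝ) * C.cst i k ≤ θ * C.gain v i k := by exact_mod_cast hk.2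
  have hdef : (C.deficit v' : ℝ) + C.gain v i k ≤ C.deficit v := by
    exact_mod_cast deficit_update hi hk.1
  -- As `θ g ≤ 3 m cst`, a fall of a gain from `g` to `g'` raises the harmonic term by at least `3 m
  -- cst (g - g') / g ≥ θ (g - g')`.
  have hharm : ∑ j ∈ Finset.range C.n, ((θ : ℝ) * C.gain v j (t j) - θ * C.gain v' j (t j)) ≤
      ∑ j ∈ Finset.range C.n, (3 * (C.m * (C.cst j (t j) : ℝ)) *
        ((harmonic C.m : ℝ) - harmonic (C.gain v' j (t j))) -
        3 * (C.m * (C.cst j (t j) : ℝ)) *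
        ((harmonic C.m : ℝ) - harmonic (C.gain v j (t j)))) := by
    refine Finset.sum_le_sum fun j hj => ?_
    obtain ⟨h1, h2⟩ := sub_le_mul_harmonic_sub (gain_anti (C := C) hle j (t j))
    have h3 : (θ : ℝ) * C.gain v j (t j) ≤ 3 * (C.m * (C.cst j (t j) : ℝ)) := by
      exact_mod_cast h.1 j (Finset.mem_range.1 hj)
    have h4 := mul_le_mul_of_nonneg_left h1 (Nat.cast_nonneg (α := ℝ) θ)
    have h5 := mul_le_mul_of_nonneg_right h3 (sub_nonneg.2 h2)
    linarith
  rw [Finset.sum_sub_distrib, Finset.sum_sub_distrib, ← Finset.mul_sum, ← Finset.mul_sum] at hharm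
  have h1 := mul_le_mul_of_nonneg_left hpaid (Nat.cast_nonneg (α := ℝ) C.m)
  have h2 := mul_le_mul_of_nonneg_left hdef (Nat.cast_nonneg (α := ℝ) θ)
  have h3 := h.2
  linarith

/-- At the price `θ`, a change of the agent `i` up to the option `k` is not worth its cost. -/
def Exhausted (C : ChainCover) (θ : ℕ) (v : ℕ → ℕ) (i k : ℕ) : Prop :=
  v i < k → θ * C.gain v i k < C.m * C.cst i k

theorem Exhausted.mono (h : C.Exhausted θ v i k) (hv : v ≤ v') : C.Exhausted θ v' i k :=
  fun hk => (Nat.mul_le_mul_left θ (gain_anti hv i k)).trans_lt (h ((hv i).trans_lt hk))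

theorem exhausted_step (θ i k : ℕ) (v : ℕ → ℕ) : C.Exhausted θ (C.step θ i k v) i k := by
  unfold step
  split_ifs with h
  · intro h'
    simp at h'
  · intro h'
    by_contra h2
    exact h ⟨h', by omega⟩

/-- Iterations of increasing maps reach and keep a property that each of them establishes. -/
theorem iter_establishes {N : ℕ} {F : ℕ → (ℕ → ℕ) → ℕ → ℕ} (p : ℕ → (ℕ → ℕ) → Prop)
    (hF : ∀ k v, v ≤ F k v) (hp : ∀ k v v', v ≤ v' → p k v → p k v')
    (hFp : ∀ k < N, ∀ v, p k (F k v)) (v : ℕ → ℕ) :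
    v ≤ iter N F v ∧ ∀ k < N, p k (iter N F v) := by
  refine iter_induction (fun K w => v ≤ w ∧ ∀ k < K, p k w) ⟨le_rfl, by simp⟩
    fun K hK w hw => ⟨hw.1.trans (hF _ _), fun k hk => ?_⟩
  rcases Nat.lt_succ_iff_lt_or_eq.1 hk with h | rfl
  · exact hp _ _ _ (hF _ _) (hw.2 k h)
  · exact hFp _ hK _

theorem row_spec (θ i : ℕ) (v : ℕ → ℕ) :
    v ≤ C.row θ i v ∧ ∀ k < C.m, C.Exhausted θ (C.row θ i v) i k :=
  iter_establishes (fun k v => C.Exhausted θ v i k) (le_step θ i)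
    (fun _ _ _ h h' => h'.mono h) (fun k _ v => exhausted_step θ i k v) v

/-- Exhaustion survives later changes since gains only fall, so a single pass settles all pairs. -/
theorem pass_spec (θ : ℕ) (v : ℕ → ℕ) :
    v ≤ C.pass θ v ∧ ∀ i < C.n, ∀ k < C.m, C.Exhausted θ (C.pass θ v) i k :=
  iter_establishes (fun i v => ∀ k < C.m, C.Exhausted θ v i k) (fun i v => (row_spec θ i v).1)
    (fun _ _ _ h h' k hk => (h' k hk).mono h) (fun i _ v => (row_spec θ i v).2) v

theorem Charged.pass (h : C.Charged t θ v) : C.Charged t θ (C.pass θ v) :=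
  iter_induction (fun _ w => C.Charged t θ w) h fun _ hi _ h' =>
    iter_induction (fun _ w => C.Charged t θ w) h' fun k _ _ h'' => h''.step hi k

/-- An exhausted option has `θ g < m cst`, hence `cst ≥ 1`, and `g ≤ m ≤ m cst` absorbs the extra
unit: `(2 θ + 1) g ≤ 3 m cst`. This is why prices are measured in units of `1 / m`. -/
theorem Charged.phase (h : C.Charged t θ v) (htm : ∀ i < C.n, t i < C.m)
    (ht : ∀ c < C.m, C.dem c ≤ C.cnt t c) :
    C.Charged t (θ + θ + 1) (C.pass θ v) := by
  have hp := h.pass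
  refine ⟨fun i hi => ?_, hp.2.trans ?_⟩
  · rcases lt_or_ge (C.pass θ v i) (t i) with hlt | hge
    · have h1 := (pass_spec (C := C) θ v).2 i hi (t i) (htm i hi) hlt
      have h2 := C.gain_le (C.pass θ v) i (t i)
      have h3 : C.m ≤ C.m * C.cst i (t i) :=
        Nat.le_mul_of_pos_right _ (Nat.pos_of_ne_zero fun h0 => by simp [h0] at h1)
      rw [add_mul, add_mul]
      omega
    · rw [gain_eq_zero hge]
      omega
  -- The total gain towards `t` is at least the deficit, so a higher price only weakens the bound.
  · have h1 : (C.deficit (C.pass θ v) : ℝ) ≤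
        ∑ i ∈ Finset.range C.n, (C.gain (C.pass θ v) i (t i) : ℝ) := by
      exact_mod_cast deficit_le ht _
    push_cast
    nlinarith [Nat.cast_nonneg (α := ℝ) θ]

theorem charged_zero (hv : ∀ i < C.n, v i = 0) (t : ℕ → ℕ) : C.Charged t 0 v := by
  refine ⟨by simp, ?_⟩
  rw [Finset.sum_eq_zero fun i hi => by rw [hv i (Finset.mem_range.1 hi), C.cst_zero, Nat.cast_zero]]
  simp only [Nat.cast_zero, mul_zero, zero_mul, add_zero]
  refine Finset.sum_nonneg fun i _ => mul_nonneg (by positivity) (sub_nonneg.2 ?_)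
  exact (sub_le_mul_harmonic_sub (C.gain_le _ _ _)).2

theorem charged_greedy (hv : ∀ i < C.n, v i = 0) (htm : ∀ i < C.n, t i < C.m) (ht : ∀ c < C.m, C.dem c ≤ C.cnt t c)
    (L : ℕ) : C.Charged t (C.greedy v L).1 (C.greedy v L).2 :=
  iter_induction (fun _ (x : ℕ × (ℕ → ℕ)) => C.Charged t x.1 x.2) (charged_zero hv t) fun _ _ _ h =>
    h.phase htm ht

theorem greedy_fst (v : ℕ → ℕ) (L : ℕ) : (C.greedy v L).1 + 1 = 2 ^ L := by
  induction L with
  | zero => rfl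
  | succ L ih =>
    have : (C.greedy v (L + 1)).1 = (C.greedy v L).1 + (C.greedy v L).1 + 1 := rfl
    rw [pow_succ]
    omega

/-- After the price has exceeded all costs, all demand is met. -/
theorem greedy_covers {L : ℕ} (hL : ∀ i < C.n, C.m * C.cst i (C.m - 1) < 2 ^ L) (c : ℕ)
    (hc : c < C.m) : C.dem c ≤ C.cnt (C.greedy v (L + 1)).2 c := by
  set w := (C.greedy v (L + 1)).2 with hw
  have hex := (pass_spec (C := C) (C.greedy v L).1 (C.greedy v L).2).2
  have hθ := C.greedy_fst v L
  change ∀ i < C.n, ∀ k < C.m, C.Exhausted _ w i k at hex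
  by_contra! hlt
  -- An agent that misses `c` could still take the option `m - 1`: its gain is at least one, and the
  -- price `2 ^ L - 1` pays for it by `hL`. Exhaustion rules this out.
  have hall : ∀ i < C.n, C.cov i (w i) c := by
    intro i hi
    by_contra hcov
    have h1 : w i < C.m - 1 := by
      by_contra! h
      exact hcov (C.cov_mono i c _ _ h (C.cov_last i hi c hc))
    have h2 := hex i hi (C.m - 1) (by omega) h1
    have h3 : 0 < C.gain w i (C.m - 1) := by
      refine Finset.sum_pos' (fun _ _ => Nat.zero_le _) ⟨c, Finset.mem_range.2 hc, ?_⟩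
      rw [if_pos ⟨hlt, C.cov_last i hi c hc, hcov⟩]
      exact one_pos
    have h4 := Nat.le_mul_of_pos_right (C.greedy v L).1 h3
    have := hL i hi
    omega
  have : C.cnt w c = C.n := by
    unfold cnt
    rw [Finset.sum_congr (g := fun _ => 1) rfl fun i hi =>
      if_pos (hall i (Finset.mem_range.1 hi))]
    simp
  have := C.dem_le c
  omega

/-- Needed because the encoding lists only the prices of shifts below `m`. -/
theorem greedy_lt (hm : 0 < C.m) (hv : v i = 0) (L : ℕ) : (C.greedy v L).2 i < C.m := by
  refine iter_induction (fun _ (x : ℕ × (ℕ → ℕ)) => x.2 i < C.m) (by simpa [hv]) fun _ _ _ h =>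
    iter_induction (fun _ (w : ℕ → ℕ) => w i < C.m) h fun j _ _ h =>
      iter_induction (fun _ (w : ℕ → ℕ) => w i < C.m) h fun k hk w h => ?_
  unfold step
  split_ifs with h'
  · by_cases hj : i = j
    · simpa [hj] using hk
    · simpa [hj] using h
  · exact h

/-- The greedy algorithm loses a factor of at most `3 (1 + log m)`. -/
theorem greedy_cost (hm : 0 < C.m) (hv : ∀ i < C.n, v i = 0) (htm : ∀ i < C.n, t i < C.m)
    (ht : ∀ c < C.m, C.dem c ≤ C.cnt t c) {L : ℕ}
    (hL : ∀ i < C.n, C.m * C.cst i (C.m - 1) < 2 ^ L) :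
    (∑ i ∈ Finset.range C.n, (C.cst i ((C.greedy v (L + 1)).2 i) : ℝ)) ≤
      3 * (1 + Real.log C.m) * ∑ i ∈ Finset.range C.n, (C.cst i (t i) : ℝ) := by
  have h := (charged_greedy hv htm ht (L + 1)).2
  have hcov := greedy_covers (v := v) hL
  set w := (C.greedy v (L + 1)).2
  -- Once all demand is met, gains and deficit vanish and each harmonic difference becomes `H_m`.
  have hg : ∀ i, C.gain w i (t i) = 0 := fun i => Finset.sum_eq_zero fun c hc => if_neg fun h => by
    have := hcov c (Finset.mem_range.1 hc)
    omega
  have hd : C.deficit w = 0 := Finset.sum_eq_zero fun c hc =>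
    Nat.sub_eq_zero_of_le (hcov c (Finset.mem_range.1 hc))
  simp only [hg, hd, Nat.cast_zero, Finset.sum_const_zero, sub_zero, mul_zero, add_zero,
    harmonic_zero, Rat.cast_zero] at h
  rw [← Finset.sum_mul, ← Finset.mul_sum, ← Finset.mul_sum] at h
  have hm' : (0 : ℝ) < C.m := by exact_mod_cast hm
  have hH := harmonic_le_one_add_log C.m
  have hs : (0 : ℝ) ≤ ∑ i ∈ Finset.range C.n, (C.cst i (t i) : ℝ) :=
    Finset.sum_nonneg fun _ _ => by positivity
  refine le_of_mul_le_mul_left (h.trans ?_) hm'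
  have := mul_le_mul_of_nonneg_left hH (mul_nonneg hm'.le hs)
  linarith

end ChainCover

/-! ## Shift bribery as a covering problem -/

namespace Election

variable {m n : ℕ}

theorem N_eq_sum (E : Election m n) (c d : Fin m) :
    E.N c d = ∑ i, if E.pos i c < E.pos i d then 1 else 0 := by
  rw [N, Finset.card_filter]

theorem N_le (E : Election m n) (c d : Fin m) : E.N c d ≤ n :=
  (Finset.card_le_univ _).trans (by simp)

theorem N_add_N (E : Election m n) {c d : Fin m} (h : c ≠ d) : E.N c d + E.N d c = n := by
  rw [N_eq_sum, N_eq_sum, ← Finset.sum_add_distrib, Finset.sum_congr (g := fun _ => 1) rfl]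
  · simp
  · intro i _
    rcases lt_or_gt_of_ne ((E.pos i).injective.ne h) with h' | h' <;> simp [h', h'.not_gt]

theorem N_shift_of_ne (E : Election m n) {p c d : Fin m} (hc : c ≠ p) (hd : d ≠ p)
    (t : Fin n → ℕ) : (E.shift p t).N c d = E.N c d := by
  rw [N_eq_sum, N_eq_sum]
  refine Finset.sum_congr rfl fun i _ => ?_
  have h1 : (E.pos i c : ℕ) ≠ E.pos i p := fun h => hc ((E.pos i).injective (Fin.ext h))
  have h2 : (E.pos i d : ℕ) ≠ E.pos i p := fun h => hd ((E.pos i).injective (Fin.ext h))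
  simp only [Fin.lt_def, E.shift_pos_of_ne hc, E.shift_pos_of_ne hd]
  congr 1
  apply propext
  split_ifs <;> omega

theorem N_shift_self (E : Election m n) {p c : Fin m} (hc : c ≠ p) (t : Fin n → ℕ) :
    (E.shift p t).N p c = ∑ i, if (E.pos i p : ℕ) - t i ≤ E.pos i c then 1 else 0 := by
  rw [N_eq_sum]
  refine Finset.sum_congr rfl fun i _ => ?_
  have h1 : (E.pos i c : ℕ) ≠ E.pos i p := fun h => hc ((E.pos i).injective (Fin.ext h))
  simp only [Fin.lt_def, E.shift_pos_of_ne hc, E.shift_pos_self]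
  congr 1
  apply propext
  split_ifs <;> omega

theorem maximinScore_le (E : Election m n) {c d : Fin m} (h : d ≠ c) :
    E.maximinScore c ≤ E.N c d :=
  ciInf_le (OrderBot.bddBelow (Set.range fun d : {d : Fin m // d ≠ c} => E.N c d)) ⟨d, h⟩

theorem exists_N_eq_maximinScore (E : Election m n) {c d : Fin m} (h : d ≠ c) :
    ∃ e ≠ c, E.N c e = E.maximinScore c := by
  have : Nonempty {d : Fin m // d ≠ c} := ⟨⟨d, h⟩⟩
  obtain ⟨e, he⟩ := exists_eq_ciInf_of_finite (f := fun d : {d : Fin m // d ≠ c} => E.N c d)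
  exact ⟨e, e.2, he⟩

end Election

namespace ShiftBribery

open Classical RAM

variable (I : ShiftBribery)

/-- The position of the candidate `c` in the vote of `i`. -/
def place (i c : ℕ) : ℕ :=
  if h : i < I.n ∧ c < I.m then I.election.pos ⟨i, h.1⟩ ⟨c, h.2⟩ else 0

/-- The price list of voter `i`. -/
def price (i k : ℕ) : ℕ := if h : i < I.n then I.cost ⟨i, h⟩ k else 0

def prefer (c d : ℕ) : ℕ :=
  ∑ i ∈ Finset.range I.n, if I.place i c < I.place i d then 1 else 0

/-- The number of voters that have to prefer `p` to `c` for the score of `p` to be at least `B`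
and the score of `c` to be at most `B`. -/
def demand (B c : ℕ) : ℕ :=
  if c = I.p then 0 else
    I.n - (I.n - if 0 < ∑ d ∈ Finset.range I.m,
        if ¬ d = c ∧ ¬ d = I.p ∧ I.prefer c d ≤ B then 1 else 0
      then B else B + (I.n - B - B))

theorem place_fin (i : Fin I.n) (c : Fin I.m) : I.place i c = I.election.pos i c := by
  simp [place]

theorem price_fin (i : Fin I.n) (k : ℕ) : I.price i k = I.cost i k := by simp [price]

theorem m_pos : 0 < I.m := I.p.pos

theorem place_lt (i c : ℕ) : I.place i c < I.m := by
  unfold place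
  split_ifs
  exacts [Fin.isLt _, I.m_pos]

theorem prefer_fin (c d : Fin I.m) : I.prefer c d = I.election.N c d := by
  rw [prefer, Finset.sum_range, Election.N_eq_sum]
  simp only [place_fin, Fin.lt_def]

/-- The covering problem for making `p` win with the score `B`. -/
def cover (B : ℕ) : ChainCover where
  n := I.n
  m := I.m
  cov i t c := I.place i I.p - t ≤ I.place i c
  cst := I.price
  dem := I.demand B
  cov_mono i c t t' h h' := by omega
  cov_last i _ c _ := by
    have := I.place_lt i I.p
    omega
  cst_zero i := by
    unfold price
    split_ifs
    exacts [I.cost_zero _, rfl]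
  dem_le c := by
    unfold demand
    split_ifs <;> omega

/-- In truncated subtraction, `B + (n - B - B)` is `max B (n - B)`, and `n - (n - x)` is `min n x`.
The minimum secures `dem_le` for all `B` and has no effect for `B ≤ n`. -/
theorem demand_of_ne {B : ℕ} (hB : B ≤ I.n) {c : Fin I.m} (hc : c ≠ I.p) :
    I.demand B c = if ∃ d, d ≠ c ∧ d ≠ I.p ∧ I.election.N c d ≤ B then B
      else max B (I.n - B) := by
  rw [demand, if_neg fun h => hc (Fin.ext h)]
  have : (0 < ∑ d ∈ Finset.range I.m,
      if ¬ d = (c : ℕ) ∧ ¬ d = I.p ∧ I.prefer c d ≤ B then 1 else 0) ↔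
      ∃ d, d ≠ c ∧ d ≠ I.p ∧ I.election.N c d ≤ B := by
    rw [Finset.sum_range, Finset.sum_pos_iff]
    refine exists_congr fun d => ?_
    simp only [Finset.mem_univ, true_and, prefer_fin, Fin.val_inj]
    split_ifs with h
    · simpa using h
    · simpa using h
  simp only [this]
  split_ifs <;> omega

theorem cnt_cover_eq_sum (B : ℕ) (v : ℕ → ℕ) (c : ℕ) : (I.cover B).cnt v c =
    ∑ i ∈ Finset.range I.n, if I.place i I.p - v i ≤ I.place i c then 1 else 0 :=
  Finset.sum_congr rfl fun i _ => by
    simp only [cover]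
    congr

theorem gain_cover_eq_sum (B : ℕ) (v : ℕ → ℕ) (i t : ℕ) : (I.cover B).gain v i t =
    ∑ c ∈ Finset.range I.m, if (I.cover B).cnt v c < I.demand B c ∧
      I.place i I.p - t ≤ I.place i c ∧ ¬ I.place i I.p - v i ≤ I.place i c then 1 else 0 :=
  Finset.sum_congr rfl fun c _ => by
    simp only [cover]
    congr

theorem cnt_cover (B : ℕ) (v : ℕ → ℕ) {c : Fin I.m} (hc : c ≠ I.p) :
    (I.cover B).cnt v c = (I.election.shift I.p fun i => v i).N I.p c := by
  rw [Election.N_shift_self _ hc, cnt_cover_eq_sum, Finset.sum_range]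
  simp only [place_fin]

/-- Covers give successful shift-actions. -/
theorem successful_of_cover {B : ℕ} (hB : B ≤ I.n) {v : ℕ → ℕ}
    (hv : ∀ c < I.m, I.demand B c ≤ (I.cover B).cnt v c) : I.Successful fun i => v i := by
  intro d
  rcases eq_or_ne d I.p with rfl | hd
  · exact le_rfl
  set E := I.election.shift I.p fun i => v i with hE
  have hcov : ∀ c ≠ I.p, (if ∃ d, d ≠ c ∧ d ≠ I.p ∧ I.election.N c d ≤ B then B
      else max B (I.n - B)) ≤ E.N I.p c := fun c hc => by
    rw [← I.demand_of_ne hB hc, ← I.cnt_cover B v hc]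
    exact hv c c.2
  trans B
  · have h := hcov d hd
    split_ifs at h with h'
    · obtain ⟨e, he, hep, h1⟩ := h'
      refine (E.maximinScore_le he).trans ?_
      rwa [Election.N_shift_of_ne _ hd hep]
    · refine (E.maximinScore_le hd.symm).trans ?_
      have := E.N_add_N hd
      omega
  · obtain ⟨e, he, h1⟩ := E.exists_N_eq_maximinScore hd
    rw [← h1]
    have h := hcov e he
    split_ifs at h <;> omega

/-- Successful shift-actions are covers for some score. -/
theorem exists_cover {t : Fin I.n → ℕ} (ht : I.Successful t) :
    ∃ B ≤ I.n, ∃ v : ℕ → ℕ, (∀ i, v i < I.m) ∧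
      (∀ c < I.m, I.demand B c ≤ (I.cover B).cnt v c) ∧
      ∑ i ∈ Finset.range I.n, I.price i (v i) = I.totalCost t := by
  -- Shifts are cut off at the top, which makes them less than `m` and changes neither the resulting
  -- comparisons with `p` nor the cost.
  set v : ℕ → ℕ := fun i => if h : i < I.n then min (t ⟨i, h⟩) (I.place i I.p) else 0 with hv
  have hvi : ∀ i : Fin I.n, v i = min (t i) (I.election.pos i I.p) := fun i => by
    simp [hv, place_fin]
  set E := I.election.shift I.p t with hE
  have hN : ∀ c ≠ I.p, ∀ B, (I.cover B).cnt v c = E.N I.p c := fun c hc B => by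
    rw [I.cnt_cover B v hc, Election.N_shift_self _ hc, Election.N_shift_self _ hc]
    refine Finset.sum_congr rfl fun i _ => ?_
    simp only [hvi]
    congr 1
    apply propext
    omega
  have hscore : E.maximinScore I.p ≤ I.n := by
    by_cases h : ∃ d, d ≠ I.p
    · obtain ⟨d, hd⟩ := h
      exact (E.maximinScore_le hd).trans (E.N_le _ _)
    -- With a single candidate the score is the infimum of the empty family, which is `0`.
    · have : IsEmpty {d : Fin I.m // d ≠ I.p} := ⟨fun d => h ⟨d, d.2⟩⟩
      simp [Election.maximinScore]
  refine ⟨E.maximinScore I.p, hscore, v, fun i => ?_, fun c hc => ?_, ?_⟩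
  · simp only [hv]
    have := I.place_lt i I.p
    have := I.m_pos
    split_ifs <;> omega
  · lift c to Fin I.m using hc
    rcases eq_or_ne c I.p with rfl | hcp
    · simp [demand]
    rw [hN c hcp, I.demand_of_ne hscore hcp]
    have h1 := E.maximinScore_le hcp
    split_ifs with h
    · exact h1
    · refine max_le h1 ?_
      obtain ⟨e, he, h2⟩ := E.exists_N_eq_maximinScore hcp.symm
      have h3 := ht c
      change E.maximinScore c ≤ E.maximinScore I.p at h3
      -- If the minimiser `e` for `c` were another candidate, `N c e` would be at most `B` already
      -- before the shift, against `h`.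
      have hep : e = I.p := by
        by_contra hep
        exact h ⟨e, he, hep, by
          rw [← I.election.N_shift_of_ne hcp hep t, ← hE]
          omega⟩
      subst hep
      have := E.N_add_N hcp
      omega
  · rw [Finset.sum_range, totalCost]
    refine Finset.sum_congr rfl fun i _ => ?_
    rw [price_fin, hvi]
    rcases le_total (t i) (I.election.pos i I.p) with h | h
    · rw [min_eq_left h]
    · rw [min_eq_right h, I.cost_top i _ h]

end ShiftBribery

/-! ## The program -/

namespace RAM

/-- `x * y`, for `x` at most the number of voters. -/
def times (s : Store) (x y : ℕ) : ℕ := ∑ k ∈ Finset.range (s.var 0), if k < x then y else 0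

/-- `m * y` -/
def scaled (s : Store) (y : ℕ) : ℕ := ∑ _k ∈ Finset.range (s.var 1), y

/-- The entry `j` of the data of voter `i`. -/
def entry (s : Store) (i j : ℕ) : ℕ := s.arr 0 (3 + (times s i (s.var 1 + s.var 1) + j))

/-- The input stores the inverse permutation; exactly one `j` contributes to the sum. -/
def place (s : Store) (i c : ℕ) : ℕ :=
  ∑ j ∈ Finset.range (s.var 1), if entry s i j = c then j else 0

def price (s : Store) (i k : ℕ) : ℕ := entry s i (s.var 1 + k)

def prefer (s : Store) (c d : ℕ) : ℕ :=
  ∑ i ∈ Finset.range (s.var 0), if place s i c < place s i d then 1 else 0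

def demand (s : Store) (B c : ℕ) : ℕ :=
  if c = s.arr 0 2 then 0 else
    s.var 0 - (s.var 0 - if 0 < ∑ d ∈ Finset.range (s.var 1),
        if ¬ d = c ∧ ¬ d = s.arr 0 2 ∧ prefer s c d ≤ B then 1 else 0
      then B else B + (s.var 0 - B - B))

def cnt (s : Store) (c : ℕ) : ℕ :=
  ∑ i ∈ Finset.range (s.var 0), if place s i (s.arr 0 2) - s.arr 2 i ≤ place s i c then 1 else 0

/-- The price times the gain. -/
def worth (s : Store) (B i t : ℕ) : ℕ :=
  ∑ c ∈ Finset.range (s.var 1),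
    if cnt s c < demand s B c ∧ place s i (s.arr 0 2) - t ≤ place s i c ∧
      ¬ place s i (s.arr 0 2) - s.arr 2 i ≤ place s i c then s.var 4 else 0

def total (s : Store) : ℕ := ∑ i ∈ Finset.range (s.var 0), price s i (s.arr 2 i)

/-- An upper bound for all scaled prices. -/
def ceiling (s : Store) : ℕ :=
  scaled s (∑ i ∈ Finset.range (s.var 0), ∑ k ∈ Finset.range (s.var 1), price s i k)

/-- Register `4` holds the price, array `2` the current options and register `2` the number of
phases; register `5` and array `1` keep the cost and the options of the best round so far. -/
def stepCmd (B i t : ℕ) (s : Store) : Store :=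
  if s.arr 2 i < t ∧ scaled s (price s i t) ≤ worth s B i t then s.setArr 2 i t else s

def rowCmd (B i : ℕ) (s : Store) : Store := iter (s.var 1) (stepCmd B i) s

def passCmd (B : ℕ) (s : Store) : Store := iter (s.var 0) (rowCmd B) s

def raiseCmd (s : Store) : Store := s.setVar 4 (s.var 4 + s.var 4 + 1)

def phaseCmd (B : ℕ) (s : Store) : Store := raiseCmd (passCmd B s)

def clearCmd (s : Store) : Store := iter (s.var 0) (fun i s => s.setArr 2 i 0) s

def greedyCmd (B : ℕ) (s : Store) : Store :=
  (fun s => iter (s.var 2) (fun _ => phaseCmd B) s) ((clearCmd s).setVar 4 0)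

def copyCmd (s : Store) : Store := iter (s.var 0) (fun i s => s.setArr 1 i (s.arr 2 i)) s

/-- The round `B = 0` is always kept, as register `5` holds no cost before it. -/
def keepCmd (B : ℕ) (s : Store) : Store :=
  if B = 0 ∨ total s < s.var 5 then copyCmd (s.setVar 5 (total s)) else s

def roundCmd (B : ℕ) (s : Store) : Store := keepCmd B (greedyCmd B s)

def mainCmd (s : Store) : Store := iter (s.var 3) roundCmd s

/-! ### Programs for the components of the algorithm -/

section Calc

variable {d : ℕ} {X Y Z : Store → ℕ}

theorem calc_times (hX : Calc d X) (hY : Calc d Y) : Calc d fun s => times s (X s) (Y s) :=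
  .sum (by omega) hX.1 fun _ hx _ hG =>
    .ite (.lt hG (hX.mono hx)) (hY.mono hx) (.const hG.1 0)

theorem calc_scaled (hY : Calc d Y) : Calc d fun s => scaled s (Y s) :=
  .sum (by omega) hY.1 fun _ hx _ _ => hY.mono hx

theorem calc_var (hd : 8 ≤ d) (y : ℕ) (hy : y < 8) : Calc d fun s => s.var y :=
  .var hd (hy.trans_le hd)

theorem calc_entry (hX : Calc d X) (hY : Calc d Y) : Calc d fun s => entry s (X s) (Y s) :=
  have h := calc_var hX.1 1 (by omega)
  .get 0 (.add (.const hX.1 3) (.add (calc_times hX (h.add h)) hY))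

theorem calc_place (hX : Calc d X) (hY : Calc d Y) : Calc d fun s => place s (X s) (Y s) :=
  .sum (by omega) hX.1 fun _ hx _ hG =>
    .ite (.eq (calc_entry (hX.mono hx) hG) (hY.mono hx)) hG (.const hG.1 0)

theorem calc_price (hX : Calc d X) (hY : Calc d Y) : Calc d fun s => price s (X s) (Y s) :=
  calc_entry hX (.add (calc_var hX.1 1 (by omega)) hY)

theorem calc_prefer (hX : Calc d X) (hY : Calc d Y) : Calc d fun s => prefer s (X s) (Y s) :=
  .sum (by omega) hX.1 fun _ hx _ hG =>
    .ite (.lt (calc_place hG (hX.mono hx)) (calc_place hG (hY.mono hx))) (.const hG.1 1)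
      (.const hG.1 0)

theorem calc_designated (hd : 8 ≤ d) : Calc d fun s => s.arr 0 2 := .get 0 (.const hd 2)

theorem calc_demand (hX : Calc d X) (hY : Calc d Y) : Calc d fun s => demand s (X s) (Y s) :=
  have hd := hX.1
  have hn := calc_var hd 0 (by omega)
  .ite (.eq hY (calc_designated hd)) (.const hd 0) <| .sub hn <| .sub hn <|
    .ite (.lt (.const hd 0) <| .sum (by omega) hd fun _ hx _ hG =>
      .ite (.and (.not (.eq hG (hY.mono hx))) <| .and (.not (.eq hG (calc_designated hG.1))) <|
        .le (calc_prefer (hY.mono hx) hG) (hX.mono hx)) (.const hG.1 1) (.const hG.1 0))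
      hX (.add hX (.sub (.sub hn hX) hX))

theorem calc_cnt (hX : Calc d X) : Calc d fun s => cnt s (X s) :=
  .sum (by omega) hX.1 fun _ hx _ hG =>
    .ite (.le (.sub (calc_place hG (calc_designated hG.1)) (.get 2 hG))
      (calc_place hG (hX.mono hx))) (.const hG.1 1) (.const hG.1 0)

theorem calc_worth (hX : Calc d X) (hY : Calc d Y) (hZ : Calc d Z) :
    Calc d fun s => worth s (X s) (Y s) (Z s) :=
  .sum (by omega) hX.1 fun _ hx _ hG =>
    have hp := calc_place (hY.mono hx) (calc_designated hG.1)
    have hc := calc_place (hY.mono hx) hG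
    .ite (.and (.lt (calc_cnt hG) (calc_demand (hX.mono hx) hG)) <|
      .and (.le (.sub hp (hZ.mono hx)) hc) <|
        .not (.le (.sub hp (.get 2 (hY.mono hx))) hc))
      (calc_var hG.1 4 (by omega)) (.const hG.1 0)

theorem calc_total (hd : 8 ≤ d) : Calc d total :=
  .sum (by omega) hd fun _ _ _ hG => calc_price hG (.get 2 hG)

theorem calc_ceiling (hd : 8 ≤ d) : Calc d ceiling :=
  calc_scaled <| .sum (by omega) hd fun _ hx _ hG => .sum (by omega) hG.1 fun _ hy _ hH =>
    calc_price (hG.mono hy) hH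

theorem cmd_step (hX : Calc d X) (hY : Calc d Y) (hZ : Calc d Z) :
    Cmd d fun s => stepCmd (X s) (Y s) (Z s) s :=
  .ite (.and (.lt (.get 2 hY) hZ) (.le (calc_scaled (calc_price hY hZ)) (calc_worth hX hY hZ)))
    (.put 2 hY hZ)

theorem cmd_row (hX : Calc d X) (hX' : Stable X) (hY : Calc d Y) (hY' : Stable Y) :
    Cmd d fun s => rowCmd (X s) (Y s) s :=
  .loop_of_stable (A := fun s => (X s, Y s)) (F := fun a => stepCmd a.1 a.2)
    (fun s s' h => by simp only [hX' s s' h, hY' s s' h]) (by omega) hX.1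
    fun _ hx _ hG _ => cmd_step (hX.mono hx) (hY.mono hx) hG

theorem cmd_phase (hX : Calc d X) (hX' : Stable X) : Cmd d fun s => phaseCmd (X s) s :=
  have h4 := calc_var hX.1 4 (by omega)
  .seq (.loop_of_stable (F := rowCmd) hX' (by omega) hX.1
    fun _ hx _ hG hG' => cmd_row (hX.mono hx) hX' hG hG')
    (.assign (by omega) (.add (.add h4 h4) (.const hX.1 1)))

theorem cmd_greedy (hX : Calc d X) (hX' : Stable X) : Cmd d fun s => greedyCmd (X s) s :=
  .seq_of_stable (G := fun B s => iter (s.var 2) (fun _ => phaseCmd B) s) hX'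
    (.seq (.loop (by omega) hX.1 fun _ _ _ hG _ => .put 2 hG (.const hG.1 0))
      (.assign (by omega) (.const hX.1 0)))
    (.loop_of_stable (F := fun B _ => phaseCmd B) hX' (by omega) hX.1
      fun _ hx _ _ _ => cmd_phase (hX.mono hx) hX')

theorem cmd_keep (hX : Calc d X) : Cmd d fun s => keepCmd (X s) s :=
  .ite (.or (.eq hX (.const hX.1 0)) (.lt (calc_total hX.1) (calc_var hX.1 5 (by omega))))
    (.seq (.assign (by omega) (calc_total hX.1))
      (.loop (by omega) hX.1 fun _ _ _ hG _ => .put 1 hG (.get 2 hG)))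

theorem cmd_main (hd : 8 ≤ d) : Cmd d mainCmd :=
  .loop (by omega) hd fun _ _ _ hG hG' =>
    .seq_of_stable (G := keepCmd) hG' (cmd_greedy hG hG') (cmd_keep hG)

end Calc

end RAM

/-! ## Correctness of the program -/

theorem List.getD_flatMap_of_length {α : Type*} {f : α → List ℕ} {k : ℕ}
    (hf : ∀ a, (f a).length = k) (l : List α) {i j : ℕ} (hi : i < l.length) (hj : j < k) :
    (l.flatMap f).getD (i * k + j) 0 = (f l[i]).getD j 0 := by
  induction l generalizing i with
  | nil => simp at hi
  | cons a l ih =>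
    rw [List.flatMap_cons]
    cases i with
    | zero =>
      rw [List.getD_append _ _ _ _ (by rw [hf]; omega)]
      simp
    | succ i =>
      have : k ≤ (i + 1) * k + j := by rw [Nat.succ_mul]; omega
      rw [List.getD_append_right _ _ _ _ (by rw [hf]; exact this), hf,
        show (i + 1) * k + j - k = i * k + j by rw [Nat.succ_mul]; omega,
        ih (by simpa using hi)]
      simp

namespace ShiftBribery

variable (I : ShiftBribery)

theorem encode_getD {i j : ℕ} (hi : i < I.n) (hj : j < I.m + I.m) :
    I.encode.getD (3 + (i * (I.m + I.m) + j)) 0 =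
      if h : j < I.m then ((I.election.pos ⟨i, hi⟩).symm ⟨j, h⟩ : ℕ)
      else I.cost ⟨i, hi⟩ (j - I.m) := by
  rw [encode, show 3 + (i * (I.m + I.m) + j) = i * (I.m + I.m) + j + 1 + 1 + 1 by ring,
    List.getD_cons_succ, List.getD_cons_succ, List.getD_cons_succ,
    List.getD_flatMap_of_length (k := I.m + I.m) (by simp) _ (by simpa using hi) hj]
  split_ifs with h
  · rw [List.getD_append _ _ _ _ (by simpa using h)]
    simp [List.getD_eq_getElem?_getD, h]
  · rw [List.getD_append_right _ _ _ _ (by simpa using h)]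
    have : j - I.m < I.m := by omega
    simp [List.getD_eq_getElem?_getD, this, ← List.map_eq_flatMap]

end ShiftBribery

namespace RAM

open ShiftBribery

/-- The parts of the memory that do not change after the initialization. -/
structure Frame (I : ShiftBribery) (s : Store) : Prop where
  input : ∀ x, s.arr 0 x = I.encode.getD x 0
  var_zero : s.var 0 = I.n
  var_one : s.var 1 = I.m
  var_three : s.var 3 = I.n + 1

namespace Frame

variable {I : ShiftBribery} {s : Store} (hs : Frame I s)
include hs

theorem designated_eq : s.arr 0 2 = I.p := by
  rw [hs.input]
  rfl

theorem times_eq {i : ℕ} (hi : i < I.n) (y : ℕ) : times s i y = i * y := by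
  rw [times, hs.var_zero, ← Finset.sum_filter, Finset.sum_const, smul_eq_mul]
  congr 1
  rw [show (Finset.range I.n).filter (· < i) = Finset.range i by
    ext; simp only [Finset.mem_filter, Finset.mem_range]; omega, Finset.card_range]

theorem scaled_eq (y : ℕ) : scaled s y = I.m * y := by
  simp [scaled, hs.var_one]

theorem entry_eq {i j : ℕ} (hi : i < I.n) (hj : j < I.m + I.m) :
    entry s i j = if h : j < I.m then ((I.election.pos ⟨i, hi⟩).symm ⟨j, h⟩ : ℕ)
      else I.cost ⟨i, hi⟩ (j - I.m) := by
  rw [entry, hs.times_eq hi, hs.var_one, hs.input, I.encode_getD hi hj]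

theorem place_eq {i c : ℕ} (hi : i < I.n) (hc : c < I.m) : place s i c = I.place i c := by
  rw [place, hs.var_one, Finset.sum_range, ShiftBribery.place, dif_pos ⟨hi, hc⟩,
    Finset.sum_eq_single (I.election.pos ⟨i, hi⟩ ⟨c, hc⟩)]
  · rw [hs.entry_eq hi (by omega), dif_pos (Fin.isLt _)]
    simp
  · intro j _ hj
    rw [hs.entry_eq hi (by omega), dif_pos j.isLt, if_neg]
    intro h
    exact hj ((Equiv.symm_apply_eq _).1 (Fin.ext h))
  · simp

theorem price_eq {i k : ℕ} (hi : i < I.n) (hk : k < I.m) : price s i k = I.price i k := by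
  rw [price, hs.var_one, hs.entry_eq hi (by omega), dif_neg (by omega), ShiftBribery.price,
    dif_pos hi, Nat.add_sub_cancel_left]

theorem prefer_eq {c d : ℕ} (hc : c < I.m) (hd : d < I.m) : prefer s c d = I.prefer c d := by
  rw [prefer, ShiftBribery.prefer, hs.var_zero]
  refine Finset.sum_congr rfl fun i hi => ?_
  rw [Finset.mem_range] at hi
  rw [hs.place_eq hi hc, hs.place_eq hi hd]

theorem demand_eq (B : ℕ) {c : ℕ} (hc : c < I.m) : demand s B c = I.demand B c := by
  rw [demand, ShiftBribery.demand, hs.var_zero, hs.var_one, hs.designated_eq]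
  rw [Finset.sum_congr rfl fun d hd => by rw [hs.prefer_eq hc (Finset.mem_range.1 hd)]]

theorem cnt_eq (B : ℕ) {c : ℕ} (hc : c < I.m) : cnt s c = (I.cover B).cnt (s.arr 2) c := by
  rw [cnt, cnt_cover_eq_sum, hs.var_zero, hs.designated_eq]
  refine Finset.sum_congr rfl fun i hi => ?_
  rw [Finset.mem_range] at hi
  rw [hs.place_eq hi hc, hs.place_eq hi I.p.isLt]

theorem worth_eq (B : ℕ) {i : ℕ} (hi : i < I.n) (t : ℕ) :
    worth s B i t = s.var 4 * (I.cover B).gain (s.arr 2) i t := by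
  rw [worth, gain_cover_eq_sum, Finset.mul_sum, hs.var_one, hs.designated_eq]
  refine Finset.sum_congr rfl fun c hc => ?_
  rw [Finset.mem_range] at hc
  rw [hs.cnt_eq B hc, hs.demand_eq B hc, hs.place_eq hi hc, hs.place_eq hi I.p.isLt, mul_ite,
    mul_one, mul_zero]

theorem total_eq (hv : ∀ i < I.n, s.arr 2 i < I.m) :
    total s = ∑ i ∈ Finset.range I.n, I.price i (s.arr 2 i) := by
  rw [total, hs.var_zero]
  refine Finset.sum_congr rfl fun i hi => ?_
  rw [Finset.mem_range] at hi
  rw [hs.price_eq hi (hv i hi)]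

theorem ceiling_eq : ceiling s =
    I.m * ∑ i ∈ Finset.range I.n, ∑ k ∈ Finset.range I.m, I.price i k := by
  rw [ceiling, hs.scaled_eq, hs.var_zero, hs.var_one]
  congr 1
  refine Finset.sum_congr rfl fun i hi => Finset.sum_congr rfl fun k hk => ?_
  rw [hs.price_eq (Finset.mem_range.1 hi) (Finset.mem_range.1 hk)]

end Frame

/-- The memory with the price `x.1` and the options `x.2`. -/
def Store.load (s : Store) (x : ℕ × (ℕ → ℕ)) : Store :=
  ⟨Function.update s.var 4 x.1, Function.update s.arr 2 x.2⟩

/-- Simulation: `g` will be `s.load`, which writes an abstract state into the memory. -/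
theorem iter_load {α β : Type*} {N : ℕ} {F : ℕ → α → α} {F' : ℕ → β → β} (g : β → α)
    (h : ∀ k < N, ∀ b, F k (g b) = g (F' k b)) (b : β) : iter N F (g b) = g (iter N F' b) := by
  induction N with
  | zero => rfl
  | succ N ih => rw [iter_succ, ih fun k hk => h k (by omega), h N (by omega), iter_succ]

section Greedy

variable {I : ShiftBribery} {s : Store} (hs : Frame I s) (B θ : ℕ)
include hs

theorem Frame.load (x : ℕ × (ℕ → ℕ)) : Frame I (s.load x) where
  input y := by simp [Store.load, hs.input]
  var_zero := by simp [Store.load, hs.var_zero]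
  var_one := by simp [Store.load, hs.var_one]
  var_three := by simp [Store.load, hs.var_three]

theorem stepCmd_load {i t : ℕ} (hi : i < I.n) (ht : t < I.m) (v : ℕ → ℕ) :
    stepCmd B i t (s.load (θ, v)) = s.load (θ, (I.cover B).step θ i t v) := by
  have h := hs.load (θ, v)
  have h1 : (s.load (θ, v)).arr 2 = v := by simp [Store.load]
  have h2 : (s.load (θ, v)).var 4 = θ := by simp [Store.load]
  rw [stepCmd, h.scaled_eq, h.price_eq hi ht, h.worth_eq B hi, h1, h2, ChainCover.step]
  change _ = s.load (θ, if v i < t ∧ I.m * I.price i t ≤ θ * (I.cover B).gain v i t then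
    Function.update v i t else v)
  by_cases hc : v i < t ∧ I.m * I.price i t ≤ θ * (I.cover B).gain v i t
  · rw [if_pos hc, if_pos hc]
    simp [Store.setArr, Store.load]
  · rw [if_neg hc, if_neg hc]

theorem passCmd_load (v : ℕ → ℕ) :
    passCmd B (s.load (θ, v)) = s.load (θ, (I.cover B).pass θ v) := by
  rw [passCmd, (hs.load _).var_zero]
  refine iter_load (fun v => s.load (θ, v)) (fun i hi v => ?_) v
  rw [rowCmd, (hs.load _).var_one]
  exact iter_load (fun v => s.load (θ, v)) (fun t ht v => stepCmd_load hs B θ hi ht v) v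

theorem phaseCmd_load (x : ℕ × (ℕ → ℕ)) :
    phaseCmd B (s.load x) = s.load ((I.cover B).phase x) := by
  rw [phaseCmd, passCmd_load hs]
  simp [raiseCmd, Store.setVar, Store.load, ChainCover.phase]

theorem greedyCmd_eq : ∃ v, (∀ i < I.n, v i = 0) ∧
    greedyCmd B s = s.load ((I.cover B).greedy v (s.var 2)) := by
  obtain ⟨v, hv, h⟩ : ∃ v, (∀ i < I.n, v i = 0) ∧
      clearCmd s = ⟨s.var, Function.update s.arr 2 v⟩ := by
    rw [clearCmd, hs.var_zero]
    refine iter_induction (a := s) (fun k (s' : Store) => ∃ v, (∀ i < k, v i = 0) ∧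
      s' = ⟨s.var, Function.update s.arr 2 v⟩) ⟨s.arr 2, by simp, by simp⟩ ?_
    rintro k _ _ ⟨v, hv, rfl⟩
    refine ⟨Function.update v k 0, fun i hi => ?_, by simp [Store.setArr]⟩
    rcases Nat.lt_succ_iff_lt_or_eq.1 hi with h | rfl
    · rw [Function.update_of_ne h.ne, hv i h]
    · simp
  refine ⟨v, hv, ?_⟩
  have h' : (clearCmd s).setVar 4 0 = s.load (0, v) := by rw [h]; rfl
  rw [greedyCmd, h']
  have h2 : (s.load (0, v)).var 2 = s.var 2 := by simp [Store.load]
  simp only [h2]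
  exact iter_load s.load (fun _ _ x => phaseCmd_load hs B x) (0, v)

theorem keepCmd_spec :
    Frame I (keepCmd B s) ∧
    if B = 0 ∨ total s < s.var 5 then
      (keepCmd B s).var 5 = total s ∧ ∀ i < I.n, (keepCmd B s).arr 1 i = s.arr 2 i
    else (keepCmd B s).var 5 = s.var 5 ∧ (keepCmd B s).arr 1 = s.arr 1 := by
  unfold keepCmd
  split_ifs with h
  · obtain ⟨w, hw, h'⟩ : ∃ w, (∀ i < I.n, w i = s.arr 2 i) ∧
        copyCmd (s.setVar 5 (total s)) =
          ⟨Function.update s.var 5 (total s), Function.update s.arr 1 w⟩ := by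
      have h0 : (s.setVar 5 (total s)).var 0 = I.n := by simp [Store.setVar, hs.var_zero]
      rw [copyCmd, h0]
      refine iter_induction (a := s.setVar 5 (total s)) (fun k (s' : Store) => ∃ w, (∀ i < k, w i = s.arr 2 i) ∧
        s' = ⟨Function.update s.var 5 (total s), Function.update s.arr 1 w⟩)
        ⟨s.arr 1, by simp, by simp [Store.setVar]⟩ ?_
      rintro k _ _ ⟨w, hw, rfl⟩
      refine ⟨Function.update w k (s.arr 2 k), fun i hi => ?_, by simp [Store.setArr]⟩
      rcases Nat.lt_succ_iff_lt_or_eq.1 hi with h | rfl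
      · rw [Function.update_of_ne h.ne, hw i h]
      · simp
    rw [h']
    refine ⟨⟨?_, ?_, ?_, ?_⟩, by simp, fun i hi => by simpa using hw i hi⟩
    · simp [hs.input]
    · simp [hs.var_zero]
    · simp [hs.var_one]
    · simp [hs.var_three]
  · exact ⟨hs, rfl, rfl⟩

end Greedy

/-- The shift-action `v` is successful and costs `x`, which is within the approximation factor of
all solutions with scores less than `K`. -/
def IsBest (I : ShiftBribery) (K : ℕ) (v : ℕ → ℕ) (x : ℕ) : Prop :=
  (I.Successful fun i => v i) ∧ I.totalCost (fun i => v i) = x ∧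
    ∀ B < K, ∀ t : ℕ → ℕ, (∀ i, t i < I.m) →
      (∀ c < I.m, I.demand B c ≤ (I.cover B).cnt t c) →
      (x : ℝ) ≤ 3 * (1 + Real.log I.m) * (∑ i ∈ Finset.range I.n, I.price i (t i) : ℕ)

theorem totalCost_eq_sum (I : ShiftBribery) (v : ℕ → ℕ) :
    I.totalCost (fun i => v i) = ∑ i ∈ Finset.range I.n, I.price i (v i) := by
  rw [Finset.sum_range, ShiftBribery.totalCost]
  simp only [price_fin]

/-- Round `B` yields a result within the factor of every cover for `B`, and keeping the cheaper
result preserves the bounds of the earlier rounds. -/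
theorem isBest_mainCmd {I : ShiftBribery} {s : Store} (hs : Frame I s) {L : ℕ}
    (h2 : s.var 2 = L + 1) (hL : ceiling s < 2 ^ L) :
    IsBest I (I.n + 1) ((mainCmd s).arr 1) ((mainCmd s).var 5) := by
  rw [hs.ceiling_eq] at hL
  have hL' : ∀ B, ∀ i < (I.cover B).n,
      (I.cover B).m * (I.cover B).cst i ((I.cover B).m - 1) < 2 ^ L := by
    intro B i hi
    refine lt_of_le_of_lt (Nat.mul_le_mul_left _ ?_) hL
    change I.price i (I.m - 1) ≤ _
    have := I.m_pos
    refine (Finset.single_le_sum (f := fun k => I.price i k) (fun _ _ => Nat.zero_le _)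
      (Finset.mem_range.2 (show I.m - 1 < I.m by omega))).trans ?_
    exact Finset.single_le_sum (f := fun i => ∑ k ∈ Finset.range I.m, I.price i k)
      (fun _ _ => Nat.zero_le _) (Finset.mem_range.2 hi)
  suffices ∀ s', s' = mainCmd s → Frame I s' ∧ s'.var 2 = L + 1 ∧
      (0 < I.n + 1 → IsBest I (I.n + 1) (s'.arr 1) (s'.var 5)) from
    (this _ rfl).2.2 (by omega)
  rintro _ rfl
  rw [mainCmd, hs.var_three]
  refine iter_induction (fun K (s' : Store) => Frame I s' ∧ s'.var 2 = L + 1 ∧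
      (0 < K → IsBest I K (s'.arr 1) (s'.var 5))) ⟨hs, h2, by simp⟩ ?_
  rintro B hB s ⟨hs, h2, hbest⟩
  obtain ⟨v, hv, hg⟩ := greedyCmd_eq hs B
  rw [h2] at hg
  have hs' := hs.load ((I.cover B).greedy v (L + 1))
  set w := ((I.cover B).greedy v (L + 1)).2 with hw
  set s' := s.load ((I.cover B).greedy v (L + 1)) with hs'_def
  have hw2 : s'.arr 2 = w := by simp [hs'_def, Store.load, hw]
  have h5 : s'.var 5 = s.var 5 := by simp [hs'_def, Store.load]
  have h1 : s'.arr 1 = s.arr 1 := by simp [hs'_def, Store.load]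
  have hwlt : ∀ i < I.n, s'.arr 2 i < I.m := fun i hi => by
    rw [hw2]
    exact ChainCover.greedy_lt I.m_pos (hv i hi) _
  have htot := hs'.total_eq hwlt
  rw [hw2] at htot
  have hnew : ∀ t : ℕ → ℕ, (∀ i, t i < I.m) →
      (∀ c < I.m, I.demand B c ≤ (I.cover B).cnt t c) →
      (total s' : ℝ) ≤ 3 * (1 + Real.log I.m) *
        (∑ i ∈ Finset.range I.n, I.price i (t i) : ℕ) := fun t ht htc => by
    have := ChainCover.greedy_cost (C := I.cover B) (t := t) I.m_pos hv (fun i _ => ht i) htc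
      (hL' B)
    rw [htot]
    push_cast
    exact this
  have hsucc : I.Successful fun i => w i :=
    I.successful_of_cover (by omega) (ChainCover.greedy_covers (hL' B))
  rw [roundCmd, hg]
  obtain ⟨hf, hk⟩ := keepCmd_spec hs' B
  refine ⟨hf, ?_, fun _ => ?_⟩
  · have h8 : Calc 8 fun _ => B := .const le_rfl B
    rw [(cmd_keep h8).2.2.1 s' 2 (by omega)]
    simp [hs'_def, Store.load, h2]
  split_ifs at hk with hc
  · have hout : (fun i : Fin I.n => (keepCmd B s').arr 1 i) = fun i : Fin I.n => w i := by
      funext i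
      rw [hk.2 i i.isLt, hw2]
    refine ⟨by rwa [hout], by rw [hout, hk.1, htot, totalCost_eq_sum], fun B' hB' t ht htc => ?_⟩
    rw [hk.1]
    rcases Nat.lt_succ_iff_lt_or_eq.1 hB' with h | rfl
    · refine le_trans ?_ ((hbest (by omega)).2.2 B' h t ht htc)
      rw [h5] at hc
      exact_mod_cast (hc.resolve_left (by omega)).le
    · exact hnew t ht htc
  · obtain ⟨h6, h7, h8⟩ := hbest (by omega)
    rw [hk.1, hk.2, h1, h5]
    refine ⟨h6, h7, fun B' hB' t ht htc => ?_⟩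
    rcases Nat.lt_succ_iff_lt_or_eq.1 hB' with h | rfl
    · exact h8 B' h t ht htc
    · refine le_trans ?_ (hnew t ht htc)
      rw [h5] at hc
      exact_mod_cast (by omega : s.var 5 ≤ total s')

/-- The best of the greedy solutions is within a factor of `O(log m)` of the optimum. -/
theorem IsBest.le_opt {I : ShiftBribery} {v : ℕ → ℕ} {x : ℕ} (h : IsBest I (I.n + 1) v x) :
    (I.totalCost (fun i => v i) : ℝ) ≤ 9 * Real.log I.m * I.opt := by
  obtain ⟨t, ht, hopt⟩ : ∃ t, I.Successful t ∧ I.opt = I.totalCost t :=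
    Nat.sInf_mem (s := {b | ∃ t, I.Successful t ∧ b = I.totalCost t})
      (I.exists_successful.elim fun t ht => ⟨_, t, ht, rfl⟩)
  obtain ⟨B, hB, w, hw, hwc, hsum⟩ := I.exists_cover ht
  have hx := h.2.2 B (by omega) w hw hwc
  rw [hsum, ← hopt, ← h.2.1] at hx
  have hm := I.m_pos
  rcases (show I.m = 1 ∨ 2 ≤ I.m by omega) with h1 | h2
  -- For `m = 1` the bound is zero since `log 1 = 0`; here `p` is on top of every vote, and all
  -- shifts are free.
  · have : I.totalCost (fun i => v i) = 0 := by
      refine Finset.sum_eq_zero fun i _ => ?_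
      have hp : (I.election.pos i I.p : ℕ) = 0 := by
        have := (I.election.pos i I.p).isLt
        omega
      rw [I.cost_top i _ (by omega), hp, I.cost_zero]
    simp [this, h1]
  · refine hx.trans (mul_le_mul_of_nonneg_right ?_ (Nat.cast_nonneg _))
    -- `3 (1 + log m) ≤ 9 log m` amounts to `1 ≤ 2 log m`, which holds from `m = 2` on.
    have h3 := Real.log_le_log (by norm_num) (show (2 : ℝ) ≤ I.m by exact_mod_cast h2)
    have := Real.log_two_gt_d9
    linarith

end RAM

/-! ## The running time -/

theorem Polynomial.eval_le_eval_nat (q : Polynomial ℕ) {x y : ℕ} (h : x ≤ y) :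
    q.eval x ≤ q.eval y := by
  rw [Polynomial.eval_eq_sum_range, Polynomial.eval_eq_sum_range]
  exact Finset.sum_le_sum fun i _ => Nat.mul_le_mul_left _ (Nat.pow_le_pow_left h i)

namespace RAM

theorem length_le_bitLength (w : List ℕ) : w.length ≤ bitLength w := by
  induction w with
  | nil => simp
  | cons a w ih =>
    simp only [bitLength, List.map_cons, List.sum_cons, List.length_cons] at ih ⊢
    omega

/-- From `a < x` and `w < b` follows `a + w < 2 x b`; the factor `2` is the separator's bit. -/
theorem sum_lt_two_pow_bitLength (w : List ℕ) : w.sum < 2 ^ bitLength w := by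
  induction w with
  | nil => simp [bitLength]
  | cons a w ih =>
    simp only [bitLength, List.map_cons, List.sum_cons] at ih ⊢
    have h1 := Nat.lt_size_self a
    rw [pow_add, pow_succ]
    set b := 2 ^ (w.map fun a => Nat.size a + 1).sum
    have h2 : 1 ≤ b := by omega
    have h3 : 1 ≤ 2 ^ a.size := Nat.one_le_two_pow
    nlinarith

/-- The binary length of register `8` is added to register `2`. -/
def halving : Prog :=
  .loop (.var 8) (.seq (.assign 2 (.add (.var 2) (.const 1))) (.assign 8 (.half (.var 8))))

/-- `L` is the bit length; its minimality lets any explicit power of two above `x` bound it. -/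
theorem exec_halving (x : ℕ) : ∀ s : Store, s.var 8 = x → ∃ L k s', Exec halving s k s' ∧
    k ≤ 9 * L + 2 ∧ x < 2 ^ L ∧ (∀ e, x < 2 ^ e → L ≤ e) ∧ s'.arr = s.arr ∧
    s'.var 2 = s.var 2 + L ∧ ∀ y, y ≠ 2 → y ≠ 8 → s'.var y = s.var y := by
  induction x using Nat.strong_induction_on with
  | _ x ih =>
    intro s hs
    rcases Nat.eq_zero_or_pos x with rfl | hx
    · exact ⟨0, _, s, .loop_false hs, by simp [Expr.cost], by simp, by simp, rfl, rfl,
        fun _ _ _ => rfl⟩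
    set s₁ : Store := ⟨Function.update (Function.update s.var 2 (s.var 2 + 1)) 8 (x / 2), s.arr⟩
      with hs₁
    obtain ⟨L, k, s', h1, h2, h3, h4, h5, h6, h7⟩ :=
      ih (x / 2) (by omega) s₁ (by simp [hs₁])
    have hbody : Exec (.seq (.assign 2 (.add (.var 2) (.const 1))) (.assign 8 (.half (.var 8))))
        s 7 s₁ := by
      have h := Exec.seq (.assign 2 (.add (.var 2) (.const 1)) s) (.assign 8 (.half (.var 8)) _)
      simpa [Expr.eval, Expr.cost, hs, hs₁] using h
    refine ⟨L + 1, _, s', .loop_true (by simp only [Expr.eval]; omega) hbody h1, ?_, ?_, ?_, h5,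
      ?_, fun y hy hy' => ?_⟩
    · simp only [Expr.cost]
      omega
    · rw [pow_succ]
      omega
    · intro e he
      cases e with
      | zero => simp at he; omega
      | succ e =>
        rw [pow_succ] at he
        have := h4 e (by omega)
        omega
    · rw [h6]
      simp [hs₁]
      omega
    · rw [h7 y hy hy']
      simp [hs₁, hy, hy']

end RAM

namespace ShiftBribery

open RAM

variable (I : ShiftBribery)

theorem length_encode : I.encode.length = I.n * (I.m + I.m) + 3 := by
  simp [encode]

theorem encode_getD_le (x : ℕ) : I.encode.getD x 0 ≤ I.encode.sum := by
  rcases lt_or_ge x I.encode.length with h | h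
  · rw [List.getD_eq_getElem _ _ h]
    exact List.le_sum_of_mem (List.getElem_mem h)
  · rw [List.getD_eq_default _ _ h]
    exact Nat.zero_le _

theorem n_le_size : I.n ≤ I.size := by
  have h := length_le_bitLength I.encode
  rw [length_encode] at h
  have := Nat.le_mul_of_pos_right I.n (show 0 < I.m + I.m by have := I.m_pos; omega)
  unfold size
  omega

/-- Without voters the encoding consists of three numbers, and `m` may be exponential in its size.
-/
theorem m_le_size (hn : 0 < I.n) : I.m ≤ I.size := by
  have h := length_le_bitLength I.encode
  rw [length_encode] at h
  have := Nat.le_mul_of_pos_left (I.m + I.m) hn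
  unfold size
  omega

/-- `m`, `n` and every single price are at most the sum `S` of the encoded numbers, which bounds the
left side by `S ^ 4`. -/
theorem ceiling_lt : I.m * ∑ i ∈ Finset.range I.n, ∑ k ∈ Finset.range I.m, I.price i k <
    2 ^ (4 * I.size) := by
  set S := I.encode.sum
  have hm : I.m ≤ S := I.encode_getD_le 0
  have hn : I.n ≤ S := I.encode_getD_le 1
  have hp : ∀ i < I.n, ∀ k < I.m, I.price i k ≤ S := fun i hi k hk => by
    refine le_trans (le_of_eq ?_) (I.encode_getD_le (3 + (i * (I.m + I.m) + (I.m + k))))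
    rw [I.encode_getD hi (by omega), dif_neg (by omega), price, dif_pos hi,
      Nat.add_sub_cancel_left]
  have hsum : ∑ i ∈ Finset.range I.n, ∑ k ∈ Finset.range I.m, I.price i k ≤ S * (S * S) := by
    refine (Finset.sum_le_card_nsmul _ _ (S * S) fun i hi => ?_).trans
      (by simpa using Nat.mul_le_mul_right (S * S) hn)
    refine (Finset.sum_le_card_nsmul _ _ S fun k hk => ?_).trans
      (by simpa using Nat.mul_le_mul_right S hm)
    exact hp i (Finset.mem_range.1 hi) k (Finset.mem_range.1 hk)
  calc _ ≤ S * (S * (S * S)) := Nat.mul_le_mul hm hsum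
    _ = S ^ 4 := by ring
    _ < (2 ^ I.size) ^ 4 := Nat.pow_lt_pow_left (sum_lt_two_pow_bitLength _) (by omega)
    _ = _ := by rw [← pow_mul, mul_comm]

theorem successful_of_n_eq_zero (h : I.n = 0) (t : Fin I.n → ℕ) : I.Successful t := by
  have hN : ∀ c d, (I.election.shift I.p t).N c d = 0 := fun c d =>
    Nat.le_zero.1 (h ▸ Election.N_le _ c d)
  intro d
  simp only [Election.maximinScore, hN]
  simp

end ShiftBribery

theorem mainTheorem4 :
    ∃ (P : RAM.Prog) (q : Polynomial ℕ) (K : ℝ), ∀ I : ShiftBribery,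
      ∃ (k : ℕ) (final : RAM.Store),
        RAM.Exec P (RAM.load I.encode) k final ∧
        k ≤ q.eval I.size ∧
        I.Successful (fun i => final.output i) ∧
        (I.totalCost (fun i => final.output i) : ℝ) ≤ K * Real.log I.m * I.opt := by
  obtain ⟨P₁, q₁, hP₁⟩ := (RAM.calc_ceiling le_rfl).2.2 8 le_rfl
  obtain ⟨P₂, q₂, hP₂⟩ := (RAM.cmd_main le_rfl).2.2.2 8 le_rfl
  -- The loop registers add up to `n + m + (L + 1) + (n + 1)`, where `n, m ≤ |I|` and `L ≤ 4 |I|`.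
  -- The summand with `36 = 9 * 4` below is the time for `halving`.
  set b : Polynomial ℕ := Polynomial.C 7 * Polynomial.X + Polynomial.C 2 with hb
  refine ⟨.seq (.assign 0 (.get 0 (.const 1))) (.ite (.var 0)
    (.seq (.assign 1 (.get 0 (.const 0))) (.seq (.assign 3 (.add (.var 0) (.const 1)))
      (.seq P₁ (.seq (.assign 2 (.const 1)) (.seq RAM.halving P₂))))) .skip),
    q₁.comp b + q₂.comp b + Polynomial.C 36 * Polynomial.X + Polynomial.C 50, 9, fun I => ?_⟩
  have hbe : b.eval I.size = 7 * I.size + 2 := by simp [hb]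
  simp only [Polynomial.eval_add, Polynomial.eval_comp, hbe, Polynomial.eval_mul,
    Polynomial.eval_C, Polynomial.eval_X]
  have hload : ∀ x, (RAM.load I.encode).arr 0 x = I.encode.getD x 0 := fun x => rfl
  set s₁ : RAM.Store := ⟨Function.update (RAM.load I.encode).var 0 I.n, (RAM.load I.encode).arr⟩
  have h₁ : RAM.Exec (.assign 0 (.get 0 (.const 1))) (RAM.load I.encode) 3 s₁ := .assign _ _ _
  rcases Nat.eq_zero_or_pos I.n with hn | hn
  -- Without voters, loops of length `m` could be exponentially long; the program stops at once, and
  -- the empty shift-action is successful.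
  · refine ⟨_, _, .seq h₁ (.ite_false hn (.skip _)), ?_, I.successful_of_n_eq_zero hn _, ?_⟩
    · simp only [RAM.Expr.cost]
      omega
    · have : IsEmpty (Fin I.n) := by rw [hn]; infer_instance
      have h0 : ∀ t, I.totalCost t = 0 := fun t => by simp [ShiftBribery.totalCost]
      have hopt : I.opt = 0 := by
        obtain ⟨t, ht⟩ := I.exists_successful
        exact Nat.le_zero.1 (Nat.sInf_le ⟨t, ht, (h0 t).symm⟩)
      simp [h0, hopt]
  set s₂ : RAM.Store := ⟨Function.update s₁.var 1 I.m, s₁.arr⟩ with hs₂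
  have h₂ : RAM.Exec (.assign 1 (.get 0 (.const 0))) s₁ 3 s₂ := .assign _ _ _
  set s₃ : RAM.Store := ⟨Function.update s₂.var 3 (I.n + 1), s₂.arr⟩ with hs₃
  have h₃ : RAM.Exec (.assign 3 (.add (.var 0) (.const 1))) s₂ 4 s₃ := .assign _ _ _
  have hf₃ : RAM.Frame I s₃ := ⟨hload, rfl, rfl, rfl⟩
  have hv₃ : s₃.var 2 = 0 := rfl
  obtain ⟨k₄, s₄, h₄, hk₄, ha₄, hc₄⟩ := hP₁ s₃
  -- Counting starts from `1` because after `L` phases the price has just reached `2 ^ L - 1`, and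
  -- one more pass at this price is needed.
  set s₅ : RAM.Store := ⟨Function.update s₄.var 2 1, s₄.arr⟩ with hs₅
  have h₅ : RAM.Exec (.assign 2 (.const 1)) s₄ 2 s₅ := .assign _ _ _
  obtain ⟨L, k₆, s₆, h₆, hk₆, hL, hL', harr, hv₆, hvar⟩ :=
    RAM.exec_halving (s₅.var 8) s₅ rfl
  have hv : ∀ y < 8, y ≠ 2 → s₆.var y = s₃.var y := fun y hy hy2 => by
    rw [hvar y hy2 (by omega), ha₄.2 y hy]
    simp [hs₅, hy2]
  have hf₆ : RAM.Frame I s₆ := by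
    refine ⟨fun x => ?_, ?_, ?_, ?_⟩
    · rw [harr, ← hf₃.input, ha₄.1]
    · rw [hv 0 (by omega) (by omega), hf₃.var_zero]
    · rw [hv 1 (by omega) (by omega), hf₃.var_one]
    · rw [hv 3 (by omega) (by omega), hf₃.var_three]
  have h58 : s₅.var 8 = RAM.ceiling s₃ := hc₄
  rw [h58, hf₃.ceiling_eq] at hL hL'
  have hv₆' : s₆.var 2 = L + 1 := by
    rw [hv₆, hs₅]
    simp [add_comm]
  obtain ⟨k₇, s₇, h₇, hk₇, ha₇⟩ := hP₂ s₆
  have hbest := RAM.isBest_mainCmd hf₆ hv₆' (by rwa [hf₆.ceiling_eq])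
  rw [ha₇.1] at hbest
  refine ⟨_, s₇, .seq h₁ (.ite_true hn.ne' (.seq h₂ (.seq h₃ (.seq h₄ (.seq h₅
    (.seq h₆ h₇)))))), ?_, hbest.1, hbest.le_opt⟩
  have hLs := hL' _ I.ceiling_lt
  have hns := I.n_le_size
  have hms := I.m_le_size hn
  have hb₃ : s₃.bound ≤ 7 * I.size + 2 := by
    rw [RAM.Store.bound, hf₃.var_zero, hf₃.var_one, hf₃.var_three, hv₃]
    omega
  have hb₆ : s₆.bound ≤ 7 * I.size + 2 := by
    rw [RAM.Store.bound, hf₆.var_zero, hf₆.var_one, hf₆.var_three, hv₆']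
    omega
  have hq₁ := q₁.eval_le_eval_nat hb₃
  have hq₂ := q₂.eval_le_eval_nat hb₆
  simp only [RAM.Expr.cost]
  omega
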